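/- A 2-tangle diagram $T$ is an unoriented link diagram in a box, consisting of two arcs and finitely many closed curves, with endpoints NW, NE at the top and SW, SE at the bottom; two diagrams are isotopic if they differ by finitely many planar isotopies and Reidemeister moves inside the box, with fixed endpoints. $T+S$ is obtained by putting $S$ to the right of $T$ and joining NE, SE of $T$ to NW, SW of $S$; $T*S$ by putting $S$ below $T$ and joining SW, SE of $T$ to NW, NE of $S$; $-T$ by switching all crossings; $T^r=-\frac1T$ by rotating $T$ counterclockwise by $90^\circ$; and $\frac1T:=-(T^r)$. $[0]$ consists of two horizontal and $[\infty]$ of two vertical arcs; $[n]$ and $\frac1{[n]}$ consist of $|n|$ horizontal, respectively vertical, twists, where the overcrossing strand of $[+1]$ runs from NW to SE and $[-1]=-[+1]$. A twist form is an expression built from $[0]$ or $[\infty]$ by successive additions of integer tangles $[n]$ on the right or left and multiplications by vertical tangles $\frac1{[n]}$ at the bottom or top ($n\in\mathbb Z$); $T$ is rational if it is isotopic to (the diagram of) a twist form. The fraction $F\in\mathbb Q\cup\{\infty\}$ of a twist form is obtained by replacing $[0],[\infty],[n],\frac1{[n]}$ by $0,\infty,n,\frac1n$ and $*$ by $x*y=\frac1{1/x+1/y}$,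 with $\frac10=\infty$, $\frac1\infty=0$, $-\infty=\infty$, and sums with a summand $\infty$ equal to $\infty$. For a rational tangle $T$, $F(T)$ denotes the fraction of any twist form isotopic to $T$ (by part 7 it does not depend on the choice). An integral coloring of $T$ assigns an integer to each arc of the diagram so that $\alpha+\gamma=2\beta$ whenever undercrossing arcs colored $\alpha,\gamma$ meet at an overcrossing arc colored $\beta$. Its color matrix is $M=\begin{pmatrix}a&b\\c&d\end{pmatrix}$, formed by the colors at NW, NE (first row) and SW, SE (second row), and its fraction is $f=\frac{b-a}{b-d}\in\mathbb Q\cup\{\infty\}$, which is defined unless $b-a=b-d=0$. We say that $f(T)=q$ if $T$ has an integral coloring whose fraction is defined, and all integral colorings of $T$ with defined fraction have fraction $q$. Theorem. 1. For every integral coloring of a 2-tangle, $a+d=b+c$. 2. If $T$ is rational, then $f(T)$ is well defined (in particular a coloring with defined fraction exists), and $f(T')=f(T)$ for every 2-tangle diagram $T'$ isotopic to $T$. 3. Let $T,S$ be 2-tangles. An integral coloring of $T+S$ restricts to integral colorings of $T$ and of $S$, and the fractions of these three colorings satisfy $f(T+S)=f(T)+f(S)$ if all three are defined. 4. Let $T$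 be a 2-tangle. Every integral coloring of $T$ extends to one of $-\frac1T$, every integral coloring of $-\frac1T$ restricts to one of $T$, and if the fraction $f(T)$ of the latter is defined, then so is that of the former, and $f(-\frac1T)=-\frac1{f(T)}$. Consequently, if $f(T)=q$ is well defined, then $f(-\frac1T)=-\frac1q$ is well defined. 5. If $T$ is rational, then $f(-T)=-f(T)$. 6. If $T$ is rational, then $f(\frac1T)=\frac1{f(T)}$. 7. If $T$ is rational, then $f(T)=F(T)$; that is, $f(T)$ equals the fraction $F$ of every twist form isotopic to $T$. -/

import Mathlib

/-! ### Two-tangle diagrams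

Diagrams are cut by horizontal lines into elementary layers and read from top to bottom.  A layer
has one elementary piece, with `pos` vertical strands to its left and any number of vertical
strands to its right. -/

/-- Elementary pieces of an unoriented diagram. The piece `cross true` is the crossing whose
overcrossing strand runs from the upper left to the lower right; in `cross false` the
overcrossing strand runs from the upper right to the lower left. -/
inductive Piece where
  /-- a local maximum: no strand above, two strands below -/
  | cap : Piece
  /-- a local minimum: two strands above, no strand below -/
  | cup : Piece
  /-- a crossing: two strands above, two strands below -/
  | cross (s : Bool) : Piece

namespace Piece

/-- Number of strands entering from above. -/
def ins : Piece → ℕ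
  | cap => 0
  | cup => 2
  | cross _ => 2

/-- Number of strands leaving below. -/
def outs : Piece → ℕ
  | cap => 2
  | cup => 0
  | cross _ => 2

/-- Switch the crossing, if the piece is one. -/
def switch : Piece → Piece
  | cap => cap
  | cup => cup
  | cross s => cross (!s)

end Piece

/-- A horizontal layer of a diagram: one elementary piece with `pos` vertical strands to its
left. -/
structure Layer where
  pos : ℕ
  piece : Piece

namespace Layer

/-- Number of strands below the layer when there are `m` strands above it. -/
def out (L : Layer) (m : ℕ) : ℕ := m - L.piece.ins + L.piece.outs

/-- Add `k` vertical strands on the left. -/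
def shift (k : ℕ) (L : Layer) : Layer := ⟨k + L.pos, L.piece⟩

/-- The colouring rules in a layer with `m` strands above it; `u j` and `v j` are the colours of
the `j`-th strand (from the left, starting with `0`) above and below the layer. Vertical strands
keep their colour, the two ends of a local extremum have the same colour, the overcrossing strand
keeps its colour `β` and the two undercrossing arcs `α`, `γ` satisfy `α + γ = 2 β`. -/
def IsColored (L : Layer) (m : ℕ) (u v : ℕ → ℤ) : Prop :=
  (∀ j, j < L.pos → v j = u j) ∧
  (∀ j, L.pos + L.piece.ins + j < m →
    v (L.pos + L.piece.outs + j) = u (L.pos + L.piece.ins + j)) ∧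
  match L.piece with
  | .cap => v L.pos = v (L.pos + 1)
  | .cup => u L.pos = u (L.pos + 1)
  | .cross true => v (L.pos + 1) = u L.pos ∧ u (L.pos + 1) + v L.pos = 2 * u L.pos
  | .cross false =>
      v L.pos = u (L.pos + 1) ∧ u L.pos + v (L.pos + 1) = 2 * u (L.pos + 1)

end Layer

/-- The layers in the list, read from top to bottom, fit together to a diagram with `m` upper and
`n` lower endpoints. -/
def IsDiagram : List Layer → ℕ → ℕ → Prop
  | [], m, n => m = n
  | L :: D, m, n => L.pos + L.piece.ins ≤ m ∧ IsDiagram D (L.out m) n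

/-- Number of strands at level `i` (just below the first `i` layers), with `m` strands on top. -/
def levelWidth : List Layer → ℕ → ℕ → ℕ
  | _, m, 0 => m
  | [], m, _ + 1 => m
  | L :: D, m, i + 1 => levelWidth D (L.out m) i

/-- `c i j` is the colour of the `j`-th strand at level `i`; all layers obey the colouring rules.
Values of `c` outside the diagram are irrelevant. -/
def IsColoredDiagram : List Layer → ℕ → (ℕ → ℕ → ℤ) → Prop
  | [], _, _ => True
  | L :: D, m, c =>
      L.IsColored m (c 0) (c 1) ∧ IsColoredDiagram D (L.out m) (fun i => c (i + 1))

theorem IsDiagram.append {D E : List Layer} {m n p : ℕ} (hD : IsDiagram D m n)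
    (hE : IsDiagram E n p) : IsDiagram (D ++ E) m p := by
  induction D generalizing m with
  | nil => cases hD; exact hE
  | cons L D ih => exact ⟨hD.1, ih hD.2⟩

theorem IsDiagram.padRight {D : List Layer} {m n : ℕ} (hD : IsDiagram D m n) (k : ℕ) :
    IsDiagram D (m + k) (n + k) := by
  induction D generalizing m with
  | nil => cases hD; rfl
  | cons L D ih =>
    obtain ⟨h1, h2⟩ := hD
    refine ⟨by omega, ?_⟩
    have h := ih h2
    have e : L.out (m + k) = L.out m + k := by simp only [Layer.out]; omega
    rwa [e]

theorem IsDiagram.padLeft {D : List Layer} {m n : ℕ} (hD : IsDiagram D m n) (k : ℕ) :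
    IsDiagram (D.map (Layer.shift k)) (k + m) (k + n) := by
  induction D generalizing m with
  | nil => cases hD; rfl
  | cons L D ih =>
    obtain ⟨h1, h2⟩ := hD
    refine ⟨by simp only [Layer.shift]; omega, ?_⟩
    have h := ih h2
    have e : (L.shift k).out (k + m) = k + L.out m := by
      simp only [Layer.out, Layer.shift]; omega
    rwa [e]

theorem IsDiagram.switch {D : List Layer} {m n : ℕ} (hD : IsDiagram D m n) :
    IsDiagram (D.map fun L => ⟨L.pos, L.piece.switch⟩) m n := by
  induction D generalizing m with
  | nil => exact hD
  | cons L D ih =>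
    obtain ⟨h1, h2⟩ := hD
    rcases L with ⟨k, g⟩
    cases g <;> exact ⟨h1, ih h2⟩

/-- A 2-tangle diagram: two upper endpoints NW, NE and two lower endpoints SW, SE. It consists of
two arcs and finitely many closed curves. -/
structure TwoTangle where
  layers : List Layer
  isDiagram : IsDiagram layers 2 2

namespace TwoTangle

/-! ### Operations -/

/-- `[0]`: two horizontal arcs. -/
def zero : TwoTangle := ⟨[⟨0, .cup⟩, ⟨0, .cap⟩], by simp [IsDiagram, Piece.ins, Layer.out, Piece.outs]⟩

/-- `[∞]`: two vertical arcs. -/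
def infty : TwoTangle := ⟨[], rfl⟩

/-- `[+1]` (for `true`) and `[-1]` (for `false`). -/
def one (s : Bool) : TwoTangle :=
  ⟨[⟨0, .cross s⟩], by simp [IsDiagram, Piece.ins, Layer.out, Piece.outs]⟩

/-- The sum `T + S`: `S` is put to the right of `T`, NE and SE of `T` are joined to NW and SW
of `S`. -/
def add (T S : TwoTangle) : TwoTangle where
  layers := [⟨1, .cap⟩] ++ T.layers ++ S.layers.map (Layer.shift 2) ++ [⟨1, .cup⟩]
  isDiagram := by
    refine ((IsDiagram.append (n := 4) ?_ (T.isDiagram.padRight 2)).append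
      (S.isDiagram.padLeft 2)).append ?_ <;>
      simp [IsDiagram, Piece.ins, Layer.out, Piece.outs]

/-- The product `T * S`: `S` is put below `T`, SW and SE of `T` are joined to NW and NE
of `S`. -/
def mul (T S : TwoTangle) : TwoTangle := ⟨T.layers ++ S.layers, T.isDiagram.append S.isDiagram⟩

/-- The mirror image `-T`: all crossings are switched. -/
def mirror (T : TwoTangle) : TwoTangle :=
  ⟨T.layers.map fun L => ⟨L.pos, L.piece.switch⟩, T.isDiagram.switch⟩

/-- The rotation `T^r = -1/T` of `T` by 90 degrees counterclockwise: the endpoints NE, SE, NW, SW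
of `T` are led to the positions NW, NE, SW, SE. -/
def rotate (T : TwoTangle) : TwoTangle where
  layers := [⟨0, .cap⟩] ++ T.layers.map (Layer.shift 1) ++ [⟨2, .cup⟩]
  isDiagram := by
    refine (IsDiagram.append (n := 4) ?_ ((T.isDiagram.padLeft 1).padRight 1)).append ?_ <;>
      simp [IsDiagram, Piece.ins, Layer.out, Piece.outs]

/-- The inverse `T^i = -(T^r)`, written `1/T`. -/
def inverse (T : TwoTangle) : TwoTangle := T.rotate.mirror

instance : Add TwoTangle := ⟨add⟩
instance : Mul TwoTangle := ⟨mul⟩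
instance : Neg TwoTangle := ⟨mirror⟩

/-- `n` horizontal twists of the same type. -/
def horizontalTwists (s : Bool) : ℕ → TwoTangle
  | 0 => zero
  | 1 => one s
  | n + 2 => horizontalTwists s (n + 1) + one s

/-- `n` vertical twists of the same type. -/
def verticalTwists (s : Bool) : ℕ → TwoTangle
  | 0 => infty
  | 1 => one s
  | n + 2 => verticalTwists s (n + 1) * one s

/-- The integer tangle `[n]`. -/
def integer (n : ℤ) : TwoTangle := horizontalTwists (decide (0 ≤ n)) n.natAbs

/-- The vertical tangle `1/[n]`. -/
def vertical (n : ℤ) : TwoTangle := verticalTwists (decide (0 ≤ n)) n.natAbs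

/-! ### Isotopy -/

/-- The local moves on diagrams: planar isotopies that change the decomposition into layers, and
the Reidemeister moves. -/
inductive Move : List Layer → List Layer → Prop
  /-- pieces that lie side by side may be moved past each other vertically -/
  | exchange (k m : ℕ) (g h : Piece) :
      Move [⟨k, g⟩, ⟨k + g.outs + m, h⟩] [⟨k + g.ins + m, h⟩, ⟨k, g⟩]
  /-- a strand with a maximum and a minimum may be straightened -/
  | zigzagRight (k : ℕ) : Move [⟨k + 1, .cap⟩, ⟨k, .cup⟩] []
  | zigzagLeft (k : ℕ) : Move [⟨k, .cap⟩, ⟨k + 1, .cup⟩] []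
  /-- a crossing may be moved from one leg of a maximum or minimum to the other -/
  | slideCap (k : ℕ) (s : Bool) :
      Move [⟨k, .cap⟩, ⟨k + 1, .cross s⟩] [⟨k + 1, .cap⟩, ⟨k, .cross (!s)⟩]
  | slideCup (k : ℕ) (s : Bool) :
      Move [⟨k + 1, .cross s⟩, ⟨k, .cup⟩] [⟨k, .cross (!s)⟩, ⟨k + 1, .cup⟩]
  /-- the Reidemeister moves -/
  | reidemeister1Cap (k : ℕ) (s : Bool) : Move [⟨k, .cap⟩, ⟨k, .cross s⟩] [⟨k, .cap⟩]
  | reidemeister1Cup (k : ℕ) (s : Bool) : Move [⟨k, .cross s⟩, ⟨k, .cup⟩] [⟨k, .cup⟩]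
  | reidemeister2 (k : ℕ) (s : Bool) : Move [⟨k, .cross s⟩, ⟨k, .cross (!s)⟩] []
  | reidemeister3 (k : ℕ) (s : Bool) :
      Move [⟨k, .cross s⟩, ⟨k + 1, .cross s⟩, ⟨k, .cross s⟩]
        [⟨k + 1, .cross s⟩, ⟨k, .cross s⟩, ⟨k + 1, .cross s⟩]

/-- Two 2-tangle diagrams differ by one local move. -/
def Step (T S : TwoTangle) : Prop :=
  ∃ A B l r : List Layer, Move l r ∧ T.layers = A ++ l ++ B ∧ S.layers = A ++ r ++ B

/-- Isotopy of 2-tangles (with fixed endpoints): a finite sequence of local moves. -/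
def Isotopic : TwoTangle → TwoTangle → Prop := Relation.EqvGen Step

end TwoTangle

/-! ### The extended rational numbers `ℚ ∪ {∞}` -/

namespace ExtRat

/-- The value of the formal fraction `p / q`, which is `∞` for `q = 0`. Meaningful only if `p`
and `q` are not both zero. -/
def ratio (p q : ℤ) : OnePoint ℚ :=
  if q = 0 then OnePoint.infty else (((p : ℚ) / (q : ℚ) : ℚ) : OnePoint ℚ)

/-- `-∞ = ∞`. -/
def neg : OnePoint ℚ → OnePoint ℚ
  | none => OnePoint.infty
  | some x => ((-x : ℚ) : OnePoint ℚ)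

/-- `1 / ∞ = 0` and `1 / 0 = ∞`. -/
def inv : OnePoint ℚ → OnePoint ℚ
  | none => ((0 : ℚ) : OnePoint ℚ)
  | some x => if x = 0 then OnePoint.infty else ((x⁻¹ : ℚ) : OnePoint ℚ)

/-- A sum with a summand `∞` is `∞`. -/
def add : OnePoint ℚ → OnePoint ℚ → OnePoint ℚ
  | some x, some y => ((x + y : ℚ) : OnePoint ℚ)
  | _, _ => OnePoint.infty

/-- `x * y = 1 / (1 / x + 1 / y)`. -/
def star (x y : OnePoint ℚ) : OnePoint ℚ := inv (add (inv x) (inv y))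

end ExtRat

/-! ### Rational tangles and the arithmetical fraction -/

/-- Twist forms: expressions built from `[0]` or `[∞]` by consecutive additions of integer tangles
`[n]` on the right or left, and multiplications by vertical tangles `1/[n]` at the bottom or top. -/
inductive TwistForm where
  | zero : TwistForm
  | infty : TwistForm
  | addRight (E : TwistForm) (n : ℤ) : TwistForm
  | addLeft (n : ℤ) (E : TwistForm) : TwistForm
  | mulBottom (E : TwistForm) (n : ℤ) : TwistForm
  | mulTop (n : ℤ) (E : TwistForm) : TwistForm

namespace TwistForm

/-- The diagram of a twist form. -/
def tangle : TwistForm → TwoTangle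
  | zero => TwoTangle.zero
  | infty => TwoTangle.infty
  | addRight E n => E.tangle + TwoTangle.integer n
  | addLeft n E => TwoTangle.integer n + E.tangle
  | mulBottom E n => E.tangle * TwoTangle.vertical n
  | mulTop n E => TwoTangle.vertical n * E.tangle

/-- The arithmetical fraction `F`. -/
def fraction : TwistForm → OnePoint ℚ
  | zero => ((0 : ℚ) : OnePoint ℚ)
  | infty => OnePoint.infty
  | addRight E n => ExtRat.add E.fraction (ExtRat.ratio n 1)
  | addLeft n E => ExtRat.add (ExtRat.ratio n 1) E.fraction
  | mulBottom E n => ExtRat.star E.fraction (ExtRat.ratio 1 n)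
  | mulTop n E => ExtRat.star (ExtRat.ratio 1 n) E.fraction

end TwistForm

namespace TwoTangle

/-- A tangle is rational if it is isotopic to one in twist form. -/
def IsRational (T : TwoTangle) : Prop := ∃ E : TwistForm, Isotopic T E.tangle

/-! ### Integral colourings and the colouring fraction -/

/-- `c` is an integral colouring of `T`; `c i j` is the colour of the `j`-th strand from the left
at level `i`, below the first `i` layers. -/
def IsColoring (T : TwoTangle) (c : ℕ → ℕ → ℤ) : Prop := IsColoredDiagram T.layers 2 c

/-- The colour matrix with rows `(NW, NE)` and `(SW, SE)`. -/
def colorMatrix (T : TwoTangle) (c : ℕ → ℕ → ℤ) : Matrix (Fin 2) (Fin 2) ℤ :=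
  !![c 0 0, c 0 1; c T.layers.length 0, c T.layers.length 1]

/-- Number of strands of `T` at level `i`. -/
def width (T : TwoTangle) (i : ℕ) : ℕ := levelWidth T.layers 2 i

/-- The colouring seen by a subdiagram whose level `0` is level `i₀`, and whose leftmost strands
are preceded by `j₀` strands. -/
def restrict (i₀ j₀ : ℕ) (c : ℕ → ℕ → ℤ) : ℕ → ℕ → ℤ := fun i j => c (i₀ + i) (j₀ + j)

end TwoTangle

/-- The fraction `(b - a) / (b - d)` of a matrix with rows `(a, b)` and `(c, d)`. -/
def matrixFraction (M : Matrix (Fin 2) (Fin 2) ℤ) : OnePoint ℚ :=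
  ExtRat.ratio (M 0 1 - M 0 0) (M 0 1 - M 1 1)

/-- The fraction `(b - a) / (b - d)` is defined, that is, it is not `0 / 0`. -/
def FractionDefined (M : Matrix (Fin 2) (Fin 2) ℤ) : Prop :=
  ¬ (M 0 1 - M 0 0 = 0 ∧ M 0 1 - M 1 1 = 0)

/-- `f(T)` is well defined with value `q`: some colouring of `T` has a colour matrix whose fraction
is defined, and all such colour matrices have the fraction `q`. -/
def TwoTangle.HasFraction (T : TwoTangle) (q : OnePoint ℚ) : Prop :=
  (∃ c, T.IsColoring c ∧ FractionDefined (T.colorMatrix c)) ∧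
  ∀ c, T.IsColoring c → FractionDefined (T.colorMatrix c) → matrixFraction (T.colorMatrix c) = q

/-! For a rational tangle the colour matrices are known exactly: they are the integer solutions of
`a + d = b + c` and `q (b - a) = p (b - d)`, where `p / q` is the fraction of a twist form. This is
`HasColorRatio`, and parts 2 and 7 follow from it at once.

It is an equivalence, so it can be propagated by composing relations. A diagram is viewed as the
relation `BoundaryColoring` between its upper and lower colours; stacking composes relations and
extra vertical strands only add equalities. Hence a local move need only be checked on its few
strands, and isotopic tangles have the same relation. By the diagonal rule, tangles joined in a sum
have the same denominator `b - d`, and those joined in a product the same numerator `b - a`. Adding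
`[n]` therefore turns `p / q` into `(p + n q) / q`, and multiplying by `1/[n]` turns it into `p / (q
+ n p)`, exactly as `F` does; induction on the twist form finishes
(`TwistForm.exists_hasColorRatio`).

The diagonal rule holds for all tangles because every layer preserves the alternating sum of the
colours. Parts 3 and 4 are read off from colourings level by level. Part 5 uses that mirror images
of moves are moves and that switching crossings negates all twist numbers, hence `F`. Part 6
combines parts 4 and 5. -/

/-! ### Locality of the colouring rule of a layer -/

/-- The colouring rule of a piece, for the colours of its strands above and below. -/
def Piece.IsColored : Piece → (ℕ → ℤ) → (ℕ → ℤ) → Prop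
  | .cap, _, v => v 0 = v 1
  | .cup, u, _ => u 0 = u 1
  | .cross true, u, v => v 1 = u 0 ∧ u 1 + v 0 = 2 * u 0
  | .cross false, u, v => v 0 = u 1 ∧ u 0 + v 1 = 2 * u 1

theorem Piece.IsColored.congr {g : Piece} {u v u' v' : ℕ → ℤ} (h : g.IsColored u v)
    (hu : ∀ j < g.ins, u j = u' j) (hv : ∀ j < g.outs, v j = v' j) : g.IsColored u' v' := by
  rcases g with _ | _ | (_ | _) <;> simp only [Piece.IsColored, Piece.ins, Piece.outs] at * <;> grind

namespace Layer

/-- Separates the rule of the piece, which does not depend on its position, from the bookkeeping of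
the vertical strands, so that later arguments can treat all pieces at once. -/
theorem isColored_iff (L : Layer) (m : ℕ) (u v : ℕ → ℤ) : L.IsColored m u v ↔
    (∀ j < L.pos, v j = u j) ∧
    (∀ j, L.pos + L.piece.ins + j < m →
      v (L.pos + L.piece.outs + j) = u (L.pos + L.piece.ins + j)) ∧
    L.piece.IsColored (fun i => u (L.pos + i)) (fun i => v (L.pos + i)) := by
  rcases L with ⟨k, g⟩
  rcases g with _ | _ | (_ | _) <;> rfl

/-- Colours are functions on all of `ℕ`; this and its analogues below let the junk values beyond the
last strand be replaced freely. -/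
theorem IsColored.congr {L : Layer} {m : ℕ} {u v u' v' : ℕ → ℤ} (h : L.IsColored m u v)
    (hm : L.pos + L.piece.ins ≤ m) (hu : ∀ j < m, u j = u' j)
    (hv : ∀ j < L.out m, v j = v' j) : L.IsColored m u' v' := by
  rw [isColored_iff] at h ⊢
  unfold out at hv
  obtain ⟨h1, h2, h3⟩ := h
  refine ⟨fun j hj => ?_, fun j hj => ?_, h3.congr (fun j hj => hu _ (by omega))
    fun j hj => hv _ (by omega)⟩
  · rw [← hu j (by omega), ← hv j (by omega), h1 j hj]
  · rw [← hu _ (by omega), ← hv _ (by omega), h2 j hj]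

theorem isColored_padRight {L : Layer} {m : ℕ} (hm : L.pos + L.piece.ins ≤ m) (k : ℕ)
    (u v : ℕ → ℤ) : L.IsColored (m + k) u v ↔
      L.IsColored m u v ∧ ∀ j < k, v (L.out m + j) = u (m + j) := by
  simp only [isColored_iff, out]
  constructor
  · rintro ⟨h1, h2, h3⟩
    refine ⟨⟨h1, fun j hj => h2 j (by omega), h3⟩, fun j hj => ?_⟩
    -- The added strand number `j` is strand number `m - pos - ins + j` to the right of the piece.
    convert h2 (m - L.pos - L.piece.ins + j) (by omega) using 2 <;> omega
  · rintro ⟨⟨h1, h2, h3⟩, h4⟩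
    refine ⟨h1, fun j hj => ?_, h3⟩
    by_cases hjm : L.pos + L.piece.ins + j < m
    · exact h2 j hjm
    · convert h4 (L.pos + L.piece.ins + j - m) (by omega) using 2 <;> omega

theorem isColored_padLeft (L : Layer) (m k : ℕ) (u v : ℕ → ℤ) :
    (L.shift k).IsColored (k + m) u v ↔
      (∀ j < k, v j = u j) ∧ L.IsColored m (fun j => u (k + j)) (fun j => v (k + j)) := by
  simp only [isColored_iff, shift, add_assoc, add_lt_add_iff_left]
  constructor
  · rintro ⟨h1, h2, h3⟩
    exact ⟨fun j hj => h1 j (by omega), fun j hj => h1 _ (by omega), h2, h3⟩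
  · rintro ⟨h0, h1, h2, h3⟩
    refine ⟨fun j hj => ?_, h2, h3⟩
    by_cases hjk : j < k
    · exact h0 j hjk
    · convert h1 (j - k) (by omega) using 2 <;> omega

theorem out_padRight {L : Layer} {m : ℕ} (hm : L.pos + L.piece.ins ≤ m) (k : ℕ) :
    L.out (m + k) = L.out m + k := by
  simp only [out]; omega

theorem out_padLeft {L : Layer} {m : ℕ} (hm : L.pos + L.piece.ins ≤ m) (k : ℕ) :
    (L.shift k).out (k + m) = k + L.out m := by
  simp only [out, shift]; omega

end Layer

/-! ### Colourings of diagrams -/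

theorem levelWidth_zero (D : List Layer) (m : ℕ) : levelWidth D m 0 = m := by
  cases D <;> rfl

theorem IsDiagram.levelWidth_length {D : List Layer} {m n : ℕ} (hD : IsDiagram D m n) :
    levelWidth D m D.length = n := by
  induction D generalizing m with
  | nil => exact hD
  | cons L D ih => exact ih hD.2

theorem IsColoredDiagram.congr {D : List Layer} {m n : ℕ} (hD : IsDiagram D m n)
    {c c' : ℕ → ℕ → ℤ} (hc : IsColoredDiagram D m c)
    (h : ∀ i ≤ D.length, ∀ j < levelWidth D m i, c i j = c' i j) : IsColoredDiagram D m c' := by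
  induction D generalizing m c c' with
  | nil => trivial
  | cons L D ih =>
    refine ⟨hc.1.congr hD.1 (fun j hj => h 0 (by simp) j hj) fun j hj => h 1 (by simp) j ?_,
      ih hD.2 hc.2 fun i hi j hj => h (i + 1) (by simpa using hi) j hj⟩
    simpa only [levelWidth, levelWidth_zero] using hj

theorem isColoredDiagram_append {D E : List Layer} {m n : ℕ} (hD : IsDiagram D m n)
    (c : ℕ → ℕ → ℤ) : IsColoredDiagram (D ++ E) m c ↔
      IsColoredDiagram D m c ∧ IsColoredDiagram E n (fun i => c (D.length + i)) := by
  induction D generalizing m c with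
  | nil => cases hD; simp [IsColoredDiagram]
  | cons L D ih =>
    simp only [List.cons_append, IsColoredDiagram, ih hD.2, and_assoc, List.length_cons]
    simp only [add_assoc, add_comm]

/-- The index of a strand added on the right changes from level to level with the width of `D`,
hence the offset `levelWidth D m i`; strands added on the left have constant indices. -/
theorem isColoredDiagram_padRight {D : List Layer} {m n : ℕ} (hD : IsDiagram D m n) (k : ℕ)
    (c : ℕ → ℕ → ℤ) : IsColoredDiagram D (m + k) c ↔ IsColoredDiagram D m c ∧
      ∀ i ≤ D.length, ∀ j < k, c i (levelWidth D m i + j) = c 0 (m + j) := by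
  induction D generalizing m c with
  | nil =>
    simp only [IsColoredDiagram, true_and, true_iff, List.length_nil, nonpos_iff_eq_zero]
    rintro _ rfl j -
    rfl
  | cons L D ih =>
    simp only [IsColoredDiagram, Layer.isColored_padRight hD.1, Layer.out_padRight hD.1,
      ih hD.2, List.length_cons]
    constructor
    · rintro ⟨⟨h1, h2⟩, h3, h4⟩
      refine ⟨⟨h1, h3⟩, fun i hi j hj => ?_⟩
      cases i with
      | zero => rfl
      | succ i => exact (h4 i (by omega) j hj).trans (h2 j hj)
    · rintro ⟨⟨h1, h3⟩, h4⟩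
      have h2 : ∀ j < k, c 1 (L.out m + j) = c 0 (m + j) := fun j hj => by
        simpa only [levelWidth, levelWidth_zero] using h4 1 (by omega) j hj
      exact ⟨⟨h1, h2⟩, h3, fun i hi j hj => (h4 (i + 1) (by omega) j hj).trans (h2 j hj).symm⟩

theorem isColoredDiagram_padLeft {D : List Layer} {m n : ℕ} (hD : IsDiagram D m n) (k : ℕ)
    (c : ℕ → ℕ → ℤ) : IsColoredDiagram (D.map (Layer.shift k)) (k + m) c ↔
      IsColoredDiagram D m (fun i j => c i (k + j)) ∧
      ∀ i ≤ D.length, ∀ j < k, c i j = c 0 j := by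
  induction D generalizing m c with
  | nil =>
    simp only [IsColoredDiagram, true_and, true_iff, List.length_nil, nonpos_iff_eq_zero,
      List.map_nil]
    rintro _ rfl j -
    rfl
  | cons L D ih =>
    simp only [List.map_cons, IsColoredDiagram, Layer.isColored_padLeft, Layer.out_padLeft hD.1,
      ih hD.2, List.length_cons]
    constructor
    · rintro ⟨⟨h1, h2⟩, h3, h4⟩
      refine ⟨⟨h2, h3⟩, fun i hi j hj => ?_⟩
      cases i with
      | zero => rfl
      | succ i => exact (h4 i (by omega) j hj).trans (h1 j hj)
    · rintro ⟨⟨h1, h3⟩, h4⟩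
      have h2 : ∀ j < k, c 1 j = c 0 j := fun j hj => h4 1 (by omega) j hj
      exact ⟨⟨h2, h1⟩, h3, fun i hi j hj => (h4 (i + 1) (by omega) j hj).trans (h2 j hj).symm⟩

theorem levelWidth_map_shift {D : List Layer} {m n : ℕ} (hD : IsDiagram D m n) (k i : ℕ) :
    levelWidth (D.map (Layer.shift k)) (k + m) i = k + levelWidth D m i := by
  induction D generalizing m i with
  | nil => cases i <;> rfl
  | cons L D ih =>
    cases i with
    | zero => rfl
    | succ i => simp only [List.map_cons, levelWidth, Layer.out_padLeft hD.1, ih hD.2]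

/-! ### The diagonal sum rule -/

/-- The alternating sum of the colours of the first `m` strands. -/
def alternatingSum (m : ℕ) (u : ℕ → ℤ) : ℤ := ∑ j ∈ Finset.range m, (-1) ^ j * u j

theorem alternatingSum_add (m k : ℕ) (u : ℕ → ℤ) : alternatingSum (m + k) u =
    alternatingSum m u + (-1) ^ m * alternatingSum k (fun j => u (m + j)) := by
  simp only [alternatingSum, Finset.sum_range_add, Finset.mul_sum, pow_add, mul_assoc]

theorem alternatingSum_congr {m : ℕ} {u v : ℕ → ℤ} (h : ∀ j < m, u j = v j) :
    alternatingSum m u = alternatingSum m v :=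
  Finset.sum_congr rfl fun j hj => by rw [h j (Finset.mem_range.1 hj)]

/-- The ends of an extremum are adjacent and cancel, and at a crossing `α + γ = 2 β` says that the
difference of the two adjacent colours is the same above and below. Each piece changes the width by
an even number, so the signs of the strands to its right do not change. -/
theorem Layer.IsColored.alternatingSum_eq {L : Layer} {m : ℕ} {u v : ℕ → ℤ}
    (h : L.IsColored m u v) (hm : L.pos + L.piece.ins ≤ m) :
    alternatingSum (L.out m) v = alternatingSum m u := by
  obtain ⟨r, rfl⟩ := Nat.exists_eq_add_of_le hm
  rw [isColored_iff] at h
  obtain ⟨h1, h2, h3⟩ := h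
  have e : L.out (L.pos + L.piece.ins + r) = L.pos + L.piece.outs + r := by
    simp only [out]; omega
  rw [e]
  simp only [alternatingSum_add]
  rw [alternatingSum_congr h1, alternatingSum_congr (m := r) fun j hj => h2 j (by omega)]
  congr 1
  · congr 2
    rcases L with ⟨k, g⟩
    rcases g with _ | _ | (_ | _) <;>
      simp [Piece.IsColored, Piece.ins, Piece.outs, alternatingSum, Finset.sum_range_succ] at * <;>
      linarith
  · congr 1
    rcases L with ⟨k, g⟩
    rcases g with _ | _ | (_ | _) <;> simp [Piece.ins, Piece.outs, pow_add]

theorem IsColoredDiagram.alternatingSum_eq {D : List Layer} {m n : ℕ} (hD : IsDiagram D m n)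
    {c : ℕ → ℕ → ℤ} (hc : IsColoredDiagram D m c) :
    alternatingSum n (c D.length) = alternatingSum m (c 0) := by
  induction D generalizing m c with
  | nil => cases hD; rfl
  | cons L D ih => exact (ih hD.2 hc.2).trans (hc.1.alternatingSum_eq hD.1)

/-! ### Boundary colourings -/

/-- Some colouring of the diagram `D` induces the colours `u` on its upper and `v` on its lower
endpoints. -/
def BoundaryColoring : List Layer → ℕ → (ℕ → ℤ) → (ℕ → ℤ) → Prop
  | [], m, u, v => ∀ j < m, u j = v j
  | L :: D, m, u, v => ∃ w, L.IsColored m u w ∧ BoundaryColoring D (L.out m) w v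

theorem BoundaryColoring.congr {D : List Layer} {m n : ℕ} (hD : IsDiagram D m n)
    {u v u' v' : ℕ → ℤ} (h : BoundaryColoring D m u v) (hu : ∀ j < m, u j = u' j)
    (hv : ∀ j < n, v j = v' j) : BoundaryColoring D m u' v' := by
  induction D generalizing m u u' with
  | nil =>
    cases hD
    exact fun j hj => (hu j hj).symm.trans ((h j hj).trans (hv j hj))
  | cons L D ih =>
    obtain ⟨w, h1, h2⟩ := h
    exact ⟨w, h1.congr hD.1 hu fun _ _ => rfl, ih hD.2 h2 fun _ _ => rfl⟩

/-- Links the recursive relation, suited to composition, with the colourings of the theorem. -/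
theorem boundaryColoring_iff {D : List Layer} {m n : ℕ} (hD : IsDiagram D m n) (u v : ℕ → ℤ) :
    BoundaryColoring D m u v ↔ ∃ c, IsColoredDiagram D m c ∧ (∀ j < m, c 0 j = u j) ∧
      ∀ j < n, c D.length j = v j := by
  induction D generalizing m u with
  | nil =>
    cases hD
    exact ⟨fun h => ⟨fun _ => u, trivial, fun _ _ => rfl, h⟩,
      fun ⟨c, _, h1, h2⟩ j hj => (h1 j hj).symm.trans (h2 j hj)⟩
  | cons L D ih =>
    constructor
    · rintro ⟨w, h1, h2⟩
      obtain ⟨c, hc, hw, hv⟩ := (ih hD.2 w).1 h2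
      refine ⟨fun i => i.casesOn u c, ⟨?_, hc⟩, fun _ _ => rfl, hv⟩
      exact h1.congr hD.1 (fun _ _ => rfl) fun j hj => (hw j hj).symm
    · rintro ⟨c, ⟨h1, h2⟩, hu, hv⟩
      exact ⟨c 1, h1.congr hD.1 hu fun _ _ => rfl,
        (ih hD.2 _).2 ⟨_, h2, fun _ _ => rfl, hv⟩⟩

theorem boundaryColoring_append {D E : List Layer} {m n p : ℕ} (hD : IsDiagram D m n)
    (hE : IsDiagram E n p) (u v : ℕ → ℤ) : BoundaryColoring (D ++ E) m u v ↔
      ∃ w, BoundaryColoring D m u w ∧ BoundaryColoring E n w v := by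
  induction D generalizing m u with
  | nil =>
    cases hD
    exact ⟨fun h => ⟨u, fun _ _ => rfl, h⟩, fun ⟨w, h1, h2⟩ =>
      h2.congr hE (fun j hj => (h1 j hj).symm) fun _ _ => rfl⟩
  | cons L D ih =>
    simp only [List.cons_append, BoundaryColoring, ih hD.2]
    tauto

theorem boundaryColoring_padRight {D : List Layer} {m n : ℕ} (hD : IsDiagram D m n) (k : ℕ)
    (u v : ℕ → ℤ) : BoundaryColoring D (m + k) u v ↔
      BoundaryColoring D m u v ∧ ∀ j < k, u (m + j) = v (n + j) := by
  simp only [boundaryColoring_iff hD, boundaryColoring_iff (hD.padRight k),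
    isColoredDiagram_padRight hD]
  constructor
  · rintro ⟨c, ⟨h1, h2⟩, hu, hv⟩
    refine ⟨⟨c, h1, fun j hj => hu j (by omega), fun j hj => hv j (by omega)⟩, fun j hj => ?_⟩
    rw [← hu _ (by omega), ← hv _ (by omega), ← h2 _ le_rfl j hj, hD.levelWidth_length]
  · rintro ⟨⟨c, h1, hu, hv⟩, h⟩
    -- Strands beyond the width of `D` at level `i` are the added ones; they keep their colour from
    -- the top.
    refine ⟨fun i j => if j < levelWidth D m i then c i j else u (m + (j - levelWidth D m i)),
      ⟨h1.congr hD fun i _ j hj => (if_pos hj).symm, fun i _ j _ => ?_⟩, fun j hj => ?_,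
      fun j hj => ?_⟩
    · simp [levelWidth_zero]
    · simp only [levelWidth_zero]
      split_ifs with hjm
      · exact hu j hjm
      · congr 1; omega
    · simp only [hD.levelWidth_length]
      split_ifs with hjm
      · exact hv j hjm
      · rw [h _ (by omega)]; congr 1; omega

theorem boundaryColoring_padLeft {D : List Layer} {m n : ℕ} (hD : IsDiagram D m n) (k : ℕ)
    (u v : ℕ → ℤ) : BoundaryColoring (D.map (Layer.shift k)) (k + m) u v ↔
      (∀ j < k, u j = v j) ∧
      BoundaryColoring D m (fun j => u (k + j)) (fun j => v (k + j)) := by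
  simp only [boundaryColoring_iff hD, boundaryColoring_iff (hD.padLeft k),
    isColoredDiagram_padLeft hD, List.length_map]
  constructor
  · rintro ⟨c, ⟨h1, h2⟩, hu, hv⟩
    refine ⟨fun j hj => ?_, _, h1, fun j hj => hu _ (by omega), fun j hj => hv _ (by omega)⟩
    rw [← hu _ (by omega), ← hv _ (by omega), ← h2 _ le_rfl j hj]
  · rintro ⟨h, c, h1, hu, hv⟩
    refine ⟨fun i j => if j < k then u j else c i (j - k), ⟨?_, ?_⟩, ?_, ?_⟩
    · simpa using h1
    · intro i _ j hj
      simp [hj]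
    · intro j hj
      by_cases hjk : j < k
      · simp [hjk]
      · simp only [hjk, if_false]
        rw [hu _ (by omega)]; congr 1; omega
    · intro j hj
      by_cases hjk : j < k
      · simp [hjk, h]
      · simp only [hjk, if_false]
        rw [hv _ (by omega)]; congr 1; omega

theorem IsDiagram.of_append {D E : List Layer} {m p : ℕ} (h : IsDiagram (D ++ E) m p) :
    ∃ n, IsDiagram D m n ∧ IsDiagram E n p := by
  induction D generalizing m with
  | nil => exact ⟨m, rfl, h⟩
  | cons L D ih =>
    obtain ⟨n, h1, h2⟩ := ih h.2
    exact ⟨n, ⟨h.1, h1⟩, h2⟩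

theorem IsDiagram.unique {D : List Layer} {m n n' : ℕ} (h : IsDiagram D m n)
    (h' : IsDiagram D m n') : n = n' :=
  h.levelWidth_length.symm.trans h'.levelWidth_length

/-! ### Invariance of boundary colourings under the local moves -/

/-- Two diagrams with `m` upper and `n` lower endpoints and the same boundary colourings. -/
structure SameColorings (l r : List Layer) (m n : ℕ) : Prop where
  left : IsDiagram l m n
  right : IsDiagram r m n
  iff : ∀ u v, BoundaryColoring l m u v ↔ BoundaryColoring r m u v

/-- Reduces a move at an arbitrary position to the same move at the leftmost position without
further strands. -/
theorem SameColorings.pad {l r : List Layer} {m n : ℕ} (h : SameColorings l r m n) (k x : ℕ) :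
    SameColorings (l.map (Layer.shift k)) (r.map (Layer.shift k)) (k + m + x) (k + n + x) where
  left := (h.left.padLeft k).padRight x
  right := (h.right.padLeft k).padRight x
  iff u v := by
    rw [boundaryColoring_padRight (h.left.padLeft k), boundaryColoring_padLeft h.left,
      boundaryColoring_padRight (h.right.padLeft k), boundaryColoring_padLeft h.right, h.iff]

/-- With numerals for `a` and `m`, the conditions on vertical strands become finite lists of
equations. -/
theorem forall_add_lt_iff (a m : ℕ) (P : ℕ → Prop) :
    (∀ j, a + j < m → P j) ↔ ∀ j < m - a, P j :=
  forall_congr' fun j => by rw [Nat.lt_sub_iff_add_lt']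

theorem forall_lt_two_iff (P : ℕ → Prop) : (∀ j < 2, P j) ↔ P 0 ∧ P 1 :=
  ⟨fun h => ⟨h 0 (by omega), h 1 (by omega)⟩, by
    rintro ⟨h0, h1⟩ j hj
    interval_cases j <;> assumption⟩

theorem forall_lt_three_iff (P : ℕ → Prop) : (∀ j < 3, P j) ↔ P 0 ∧ P 1 ∧ P 2 :=
  ⟨fun h => ⟨h 0 (by omega), h 1 (by omega), h 2 (by omega)⟩, by
    rintro ⟨h0, h1, h2⟩ j hj
    interval_cases j <;> assumption⟩

/-- The colours of three strands. -/
def triple (a b c : ℤ) : ℕ → ℤ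
  | 0 => a
  | 1 => b
  | _ => c

namespace SameColorings

set_option linter.unusedSimpArgs false

theorem zigzagRight :
    SameColorings [⟨1, .cap⟩, ⟨0, .cup⟩] [] 1 1 := by
  refine ⟨by simp [IsDiagram, Piece.ins, Layer.out, Piece.outs], rfl,
    fun u v => ?_⟩
  simp [BoundaryColoring, Layer.IsColored, Layer.out, Piece.ins, Piece.outs, forall_add_lt_iff,
    forall_lt_two_iff, forall_lt_three_iff]
  constructor
  · intro h
    obtain ⟨w, h1, x, h2, h3⟩ := h
    exact by grind
  · intro h
    obtain h := h
    exact ⟨fun _ => u 0, by grind [triple], v, by grind [triple], by grind [triple]⟩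

theorem zigzagLeft :
    SameColorings [⟨0, .cap⟩, ⟨1, .cup⟩] [] 1 1 := by
  refine ⟨by simp [IsDiagram, Piece.ins, Layer.out, Piece.outs], rfl,
    fun u v => ?_⟩
  simp [BoundaryColoring, Layer.IsColored, Layer.out, Piece.ins, Piece.outs, forall_add_lt_iff,
    forall_lt_two_iff, forall_lt_three_iff]
  constructor
  · intro h
    obtain ⟨w, h1, x, h2, h3⟩ := h
    exact by grind
  · intro h
    obtain h := h
    exact ⟨fun _ => u 0, by grind [triple], v, by grind [triple], by grind [triple]⟩

theorem slideCap (s : Bool) :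
    SameColorings [⟨0, .cap⟩, ⟨1, .cross s⟩] [⟨1, .cap⟩, ⟨0, .cross (!s)⟩] 1 3 := by
  refine ⟨by simp [IsDiagram, Piece.ins, Layer.out, Piece.outs],
    by simp [IsDiagram, Piece.ins, Layer.out, Piece.outs],
    fun u v => ?_⟩
  cases s
  · simp [BoundaryColoring, Layer.IsColored, Layer.out, Piece.ins, Piece.outs, forall_add_lt_iff,
      forall_lt_two_iff, forall_lt_three_iff]
    constructor
    · intro h
      obtain ⟨w, h1, x, h2, h3⟩ := h
      -- The colour of the new maximum is read off at the endpoint reached by the leg without the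
      -- crossing: `v 2` here, `v 0` in the converse.
      exact ⟨triple (u 0) (v 2) (v 2), by grind [triple], v, by grind [triple], by grind [triple]⟩
    · intro h
      obtain ⟨w, h1, x, h2, h3⟩ := h
      exact ⟨triple (v 0) (v 0) (u 0), by grind [triple], v, by grind [triple], by grind [triple]⟩
  · simp [BoundaryColoring, Layer.IsColored, Layer.out, Piece.ins, Piece.outs, forall_add_lt_iff,
      forall_lt_two_iff, forall_lt_three_iff]
    constructor
    · intro h
      obtain ⟨w, h1, x, h2, h3⟩ := h
      exact ⟨triple (u 0) (v 2) (v 2), by grind [triple], v, by grind [triple], by grind [triple]⟩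
    · intro h
      obtain ⟨w, h1, x, h2, h3⟩ := h
      exact ⟨triple (v 0) (v 0) (u 0), by grind [triple], v, by grind [triple], by grind [triple]⟩

theorem slideCup (s : Bool) :
    SameColorings [⟨1, .cross s⟩, ⟨0, .cup⟩] [⟨0, .cross (!s)⟩, ⟨1, .cup⟩] 3 1 := by
  refine ⟨by simp [IsDiagram, Piece.ins, Layer.out, Piece.outs],
    by simp [IsDiagram, Piece.ins, Layer.out, Piece.outs],
    fun u v => ?_⟩
  cases s
  · simp [BoundaryColoring, Layer.IsColored, Layer.out, Piece.ins, Piece.outs, forall_add_lt_iff,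
      forall_lt_two_iff, forall_lt_three_iff]
    constructor
    · intro h
      obtain ⟨w, h1, x, h2, h3⟩ := h
      exact ⟨triple (v 0) (u 2) (u 2), by grind [triple], v, by grind [triple], by grind [triple]⟩
    · intro h
      obtain ⟨w, h1, x, h2, h3⟩ := h
      exact ⟨triple (u 0) (u 0) (v 0), by grind [triple], v, by grind [triple], by grind [triple]⟩
  · simp [BoundaryColoring, Layer.IsColored, Layer.out, Piece.ins, Piece.outs, forall_add_lt_iff,
      forall_lt_two_iff, forall_lt_three_iff]
    constructor
    · intro h
      obtain ⟨w, h1, x, h2, h3⟩ := h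
      exact ⟨triple (v 0) (u 2) (u 2), by grind [triple], v, by grind [triple], by grind [triple]⟩
    · intro h
      obtain ⟨w, h1, x, h2, h3⟩ := h
      exact ⟨triple (u 0) (u 0) (v 0), by grind [triple], v, by grind [triple], by grind [triple]⟩

theorem reidemeister1Cap (s : Bool) :
    SameColorings [⟨0, .cap⟩, ⟨0, .cross s⟩] [⟨0, .cap⟩] 0 2 := by
  refine ⟨by simp [IsDiagram, Piece.ins, Layer.out, Piece.outs],
    by simp [IsDiagram, Piece.ins, Layer.out, Piece.outs],
    fun u v => ?_⟩
  cases s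
  · simp [BoundaryColoring, Layer.IsColored, Layer.out, Piece.ins, Piece.outs, forall_add_lt_iff,
      forall_lt_two_iff, forall_lt_three_iff]
    constructor
    · intro h
      obtain ⟨w, h1, x, h2, h3⟩ := h
      exact ⟨v, by grind [triple], by grind [triple]⟩
    · intro h
      obtain ⟨w, h1, h2⟩ := h
      exact ⟨fun _ => v 0, by grind [triple], v, by grind [triple], by grind [triple]⟩
  · simp [BoundaryColoring, Layer.IsColored, Layer.out, Piece.ins, Piece.outs, forall_add_lt_iff,
      forall_lt_two_iff, forall_lt_three_iff]
    constructor
    · intro h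
      obtain ⟨w, h1, x, h2, h3⟩ := h
      exact ⟨v, by grind [triple], by grind [triple]⟩
    · intro h
      obtain ⟨w, h1, h2⟩ := h
      exact ⟨fun _ => v 0, by grind [triple], v, by grind [triple], by grind [triple]⟩

theorem reidemeister1Cup (s : Bool) :
    SameColorings [⟨0, .cross s⟩, ⟨0, .cup⟩] [⟨0, .cup⟩] 2 0 := by
  refine ⟨by simp [IsDiagram, Piece.ins, Layer.out, Piece.outs],
    by simp [IsDiagram, Piece.ins, Layer.out, Piece.outs],
    fun u v => ?_⟩
  cases s
  · simp [BoundaryColoring, Layer.IsColored, Layer.out, Piece.ins, Piece.outs, forall_add_lt_iff,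
      forall_lt_two_iff, forall_lt_three_iff]
    constructor
    · intro h
      obtain ⟨w, h1, h2⟩ := h
      -- No strand remains below the minimum, so any function may serve as the colours there.
      exact ⟨⟨u, by intro j hj; omega⟩, by grind⟩
    · intro h
      obtain h := h
      exact ⟨fun _ => u 0, by grind, ⟨u, by intro j hj; omega⟩, rfl⟩
  · simp [BoundaryColoring, Layer.IsColored, Layer.out, Piece.ins, Piece.outs, forall_add_lt_iff,
      forall_lt_two_iff, forall_lt_three_iff]
    constructor
    · intro h
      obtain ⟨w, h1, h2⟩ := h
      exact ⟨⟨u, by intro j hj; omega⟩, by grind⟩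
    · intro h
      obtain h := h
      exact ⟨fun _ => u 0, by grind, ⟨u, by intro j hj; omega⟩, rfl⟩

theorem reidemeister2 (s : Bool) :
    SameColorings [⟨0, .cross s⟩, ⟨0, .cross (!s)⟩] [] 2 2 := by
  refine ⟨by simp [IsDiagram, Piece.ins, Layer.out, Piece.outs], rfl,
    fun u v => ?_⟩
  cases s
  · simp [BoundaryColoring, Layer.IsColored, Layer.out, Piece.ins, Piece.outs, forall_add_lt_iff,
      forall_lt_two_iff, forall_lt_three_iff]
    constructor
    · intro h
      obtain ⟨w, h1, x, h2, h3⟩ := h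
      exact by grind
    · intro h
      obtain h := h
      exact ⟨triple (u 1) (2 * u 1 - u 0) 0, by grind [triple],
        v, by grind [triple], by grind [triple]⟩
  · simp [BoundaryColoring, Layer.IsColored, Layer.out, Piece.ins, Piece.outs, forall_add_lt_iff,
      forall_lt_two_iff, forall_lt_three_iff]
    constructor
    · intro h
      obtain ⟨w, h1, x, h2, h3⟩ := h
      exact by grind
    · intro h
      obtain h := h
      exact ⟨triple (2 * u 0 - u 1) (u 0) 0, by grind [triple],
        v, by grind [triple], by grind [triple]⟩

/-- Passing under a strand of colour `y` sends `x` to `2 y - x`, and this operation is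
self-distributive. The witnesses are the colours forced by `u` level by level on the other side of
the move. -/
theorem reidemeister3 (s : Bool) :
    SameColorings [⟨0, .cross s⟩, ⟨1, .cross s⟩, ⟨0, .cross s⟩]
      [⟨1, .cross s⟩, ⟨0, .cross s⟩, ⟨1, .cross s⟩] 3 3 := by
  refine ⟨by simp [IsDiagram, Piece.ins, Layer.out, Piece.outs],
    by simp [IsDiagram, Piece.ins, Layer.out, Piece.outs],
    fun u v => ?_⟩
  cases s
  · simp [BoundaryColoring, Layer.IsColored, Layer.out, Piece.ins, Piece.outs, forall_add_lt_iff,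
      forall_lt_two_iff, forall_lt_three_iff]
    constructor
    · intro h
      obtain ⟨w, h1, x, h2, y, h3, h4⟩ := h
      exact ⟨triple (u 0) (u 2) (2 * u 2 - u 1), by grind [triple],
        triple (u 2) (2 * u 2 - u 0) (2 * u 2 - u 1), by grind [triple],
        v, by grind [triple], by grind [triple]⟩
    · intro h
      obtain ⟨w, h1, x, h2, y, h3, h4⟩ := h
      exact ⟨triple (u 1) (2 * u 1 - u 0) (u 2), by grind [triple],
        triple (u 1) (u 2) (2 * u 2 - 2 * u 1 + u 0), by grind [triple],
        v, by grind [triple], by grind [triple]⟩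
  · simp [BoundaryColoring, Layer.IsColored, Layer.out, Piece.ins, Piece.outs, forall_add_lt_iff,
      forall_lt_two_iff, forall_lt_three_iff]
    constructor
    · intro h
      obtain ⟨w, h1, x, h2, y, h3, h4⟩ := h
      exact ⟨triple (u 0) (2 * u 1 - u 2) (u 1), by grind [triple],
        triple (2 * u 0 - 2 * u 1 + u 2) (u 0) (u 1), by grind [triple],
        v, by grind [triple], by grind [triple]⟩
    · intro h
      obtain ⟨w, h1, x, h2, y, h3, h4⟩ := h
      exact ⟨triple (2 * u 0 - u 1) (u 0) (u 2), by grind [triple],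
        triple (2 * u 0 - u 1) (2 * u 0 - u 2) (u 0), by grind [triple],
        v, by grind [triple], by grind [triple]⟩

theorem exchange (k m x : ℕ) (g h : Piece) :
    SameColorings [⟨k, g⟩, ⟨k + g.outs + m, h⟩] [⟨k + g.ins + m, h⟩, ⟨k, g⟩]
      (k + g.ins + m + h.ins + x) (k + g.outs + m + h.outs + x) := by
  refine ⟨by simp only [IsDiagram, Layer.out]; omega, by simp only [IsDiagram, Layer.out]; omega,
    fun u v => ?_⟩
  have e1 : k + g.ins + m + h.ins + x - g.ins + g.outs = k + g.outs + m + h.ins + x := by omega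
  have e2 : k + g.ins + m + h.ins + x - h.ins + h.outs = k + g.ins + m + h.outs + x := by omega
  have e3 : k + g.outs + m + h.ins + x - h.ins + h.outs = k + g.outs + m + h.outs + x := by omega
  have e4 : k + g.ins + m + h.outs + x - g.ins + g.outs = k + g.outs + m + h.outs + x := by omega
  simp only [BoundaryColoring, Layer.isColored_iff, Layer.out, e1, e2, e3, e4]
  constructor
  · rintro ⟨w, ⟨a1, a2, a3⟩, w', ⟨b1, b2, b3⟩, hv⟩
    have c1 : ∀ j < h.ins, w (k + g.outs + m + j) = u (k + g.ins + m + j) := fun j hj => by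
      simpa only [add_assoc] using a2 (m + j) (by omega)
    have c2 : ∀ j < x, w (k + g.outs + m + h.ins + j) = u (k + g.ins + m + h.ins + j) :=
      fun j hj => by simpa only [add_assoc] using a2 (m + h.ins + j) (by omega)
    -- Between the two pieces, now with `h` above `g`, the strands left of `h` are still coloured as
    -- on top, and those from `h` on already as at the bottom, with indices corrected for the
    -- strands of `g`.
    refine ⟨fun j => if j < k + g.ins + m then u j else v (j - g.ins + g.outs),
      ⟨fun j hj => if_pos hj, fun j hj => ?_, b3.congr (fun j hj => ?_)
        fun j hj => ?_⟩, v, ⟨fun j hj => ?_, fun j hj => ?_, a3.congr (fun j hj => ?_)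
        fun j hj => ?_⟩, fun _ _ => rfl⟩
    all_goals grind
  · rintro ⟨w, ⟨a1, a2, a3⟩, w', ⟨b1, b2, b3⟩, hv⟩
    have c1 : ∀ j < h.outs, w' (k + g.outs + m + j) = w (k + g.ins + m + j) := fun j hj => by
      simpa only [add_assoc] using b2 (m + j) (by omega)
    have c2 : ∀ j < x, w' (k + g.outs + m + h.outs + j) = w (k + g.ins + m + h.outs + j) :=
      fun j hj => by simpa only [add_assoc] using b2 (m + h.outs + j) (by omega)
    refine ⟨fun j => if j < k + g.outs + m then v j else u (j - g.outs + g.ins),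
      ⟨fun j hj => ?_, fun j hj => ?_, b3.congr (fun j hj => ?_) fun j hj => ?_⟩, v,
      ⟨fun j hj => ?_, fun j hj => ?_, a3.congr (fun j hj => ?_) fun j hj => ?_⟩,
      fun _ _ => rfl⟩
    all_goals grind

end SameColorings

/-- A local move keeps the boundary colourings. -/
theorem TwoTangle.Move.sameColorings {l r : List Layer} (h : TwoTangle.Move l r) {m n n' : ℕ}
    (hl : IsDiagram l m n) (hr : IsDiagram r m n') : SameColorings l r m n := by
  have key : ∀ {l r : List Layer} {m₀ n₀ : ℕ}, SameColorings l r m₀ n₀ → ∀ k m n : ℕ,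
      IsDiagram (l.map (Layer.shift k)) m n → k + m₀ ≤ m →
      SameColorings (l.map (Layer.shift k)) (r.map (Layer.shift k)) m n := by
    intro l r m₀ n₀ h k m n hl hm
    obtain ⟨x, rfl⟩ := Nat.exists_eq_add_of_le hm
    have h' := h.pad k x
    rwa [h'.left.unique hl] at h'
  cases h with
  | exchange k j g g' =>
    have hm : k + g.ins + j + g'.ins ≤ m := by
      simp only [IsDiagram, Layer.out] at hl hr; omega
    obtain ⟨x, rfl⟩ := Nat.exists_eq_add_of_le hm
    have h' := SameColorings.exchange k j x g g'
    rwa [h'.left.unique hl] at h'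
  | zigzagRight k => exact key .zigzagRight k m n hl (by
      simp [IsDiagram, Layer.out, Piece.ins, Piece.outs] at hl; omega)
  | zigzagLeft k => exact key .zigzagLeft k m n hl (by
      simp [IsDiagram, Layer.out, Piece.ins, Piece.outs] at hl; omega)
  | slideCap k s => exact key (.slideCap s) k m n hl hr.1
  | slideCup k s => exact key (.slideCup s) k m n hl hl.1
  | reidemeister1Cap k s => exact key (.reidemeister1Cap s) k m n hl hl.1
  | reidemeister1Cup k s => exact key (.reidemeister1Cup s) k m n hl hl.1
  | reidemeister2 k s => exact key (.reidemeister2 s) k m n hl hl.1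
  | reidemeister3 k s => exact key (.reidemeister3 s) k m n hl hr.1

namespace TwoTangle

theorem Step.boundaryColoring_iff {T S : TwoTangle} (h : Step T S) (u v : ℕ → ℤ) :
    BoundaryColoring T.layers 2 u v ↔ BoundaryColoring S.layers 2 u v := by
  obtain ⟨A, B, l, r, hlr, hT, hS⟩ := h
  obtain ⟨n, h1, hB⟩ := (hT ▸ T.isDiagram).of_append
  obtain ⟨m, hA, hl⟩ := h1.of_append
  obtain ⟨n', h1', hB'⟩ := (hS ▸ S.isDiagram).of_append
  obtain ⟨m', hA', hr⟩ := h1'.of_append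
  obtain rfl := hA.unique hA'
  have key := hlr.sameColorings hl hr
  -- Both sides of the move end with the same number of strands, so `B` continues them at the same
  -- width.
  obtain rfl := key.right.unique hr
  rw [hT, hS, boundaryColoring_append h1 hB, boundaryColoring_append h1' hB]
  simp only [boundaryColoring_append hA hl, boundaryColoring_append hA hr, key.iff]

theorem Isotopic.boundaryColoring_iff {T S : TwoTangle} (h : Isotopic T S) (u v : ℕ → ℤ) :
    BoundaryColoring T.layers 2 u v ↔ BoundaryColoring S.layers 2 u v := by
  induction h with
  | rel _ _ h => exact h.boundaryColoring_iff u v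
  | refl _ => rfl
  | symm _ _ _ ih => exact ih.symm
  | trans _ _ _ _ _ ih1 ih2 => exact ih1.trans ih2

/-! ### Mirror images of isotopies and twist forms -/

theorem Move.switch {l r : List Layer} (h : Move l r) :
    Move (l.map fun L => ⟨L.pos, L.piece.switch⟩) (r.map fun L => ⟨L.pos, L.piece.switch⟩) := by
  have hi : ∀ g : Piece, g.switch.ins = g.ins := by rintro (_ | _ | _) <;> rfl
  have ho : ∀ g : Piece, g.switch.outs = g.outs := by rintro (_ | _ | _) <;> rfl
  cases h with
  | exchange k m g h =>
    have := Move.exchange k m g.switch h.switch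
    rwa [hi, ho] at this
  | zigzagRight k => exact .zigzagRight k
  | zigzagLeft k => exact .zigzagLeft k
  | slideCap k s => exact .slideCap k !s
  | slideCup k s => exact .slideCup k !s
  | reidemeister1Cap k s => exact .reidemeister1Cap k !s
  | reidemeister1Cup k s => exact .reidemeister1Cup k !s
  | reidemeister2 k s => exact .reidemeister2 k !s
  | reidemeister3 k s => exact .reidemeister3 k !s

theorem Isotopic.neg {T S : TwoTangle} (h : Isotopic T S) : Isotopic (-T) (-S) := by
  induction h with
  | rel T S h =>
    obtain ⟨A, B, l, r, hlr, hT, hS⟩ := h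
    refine .rel _ _ ⟨A.map fun L => ⟨L.pos, L.piece.switch⟩,
      B.map fun L => ⟨L.pos, L.piece.switch⟩, _, _, hlr.switch, ?_, ?_⟩
    · change List.map _ T.layers = _
      rw [hT, List.map_append, List.map_append]
    · change List.map _ S.layers = _
      rw [hS, List.map_append, List.map_append]
  | refl _ => exact .refl _
  | symm _ _ _ ih => exact .symm _ _ ih
  | trans _ _ _ _ _ ih1 ih2 => exact .trans _ _ _ ih1 ih2

theorem ext {T S : TwoTangle} (h : T.layers = S.layers) : T = S := by
  cases T; cases S; cases h; rfl

theorem neg_add' (T S : TwoTangle) : -(T + S) = -T + -S := by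
  apply ext
  change List.map _ ([_] ++ T.layers ++ List.map _ S.layers ++ [_]) =
    [_] ++ List.map _ T.layers ++ List.map _ (List.map _ S.layers) ++ [_]
  simp [Function.comp_def, Layer.shift, Piece.switch]

theorem neg_mul' (T S : TwoTangle) : -(T * S) = -T * -S :=
  ext List.map_append

theorem neg_rotate (T : TwoTangle) : -T.rotate = (-T).rotate := by
  apply ext
  change List.map _ ([_] ++ List.map _ T.layers ++ [_]) =
    [_] ++ List.map _ (List.map _ T.layers) ++ [_]
  simp [Function.comp_def, Layer.shift, Piece.switch]

theorem neg_horizontalTwists (s : Bool) (n : ℕ) :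
    -horizontalTwists s n = horizontalTwists (!s) n := by
  induction n using horizontalTwists.induct with
  | case1 => rfl
  | case2 => rfl
  | case3 n ih =>
    simp only [horizontalTwists, neg_add', ih]
    rfl

theorem neg_verticalTwists (s : Bool) (n : ℕ) :
    -verticalTwists s n = verticalTwists (!s) n := by
  induction n using verticalTwists.induct with
  | case1 => rfl
  | case2 => rfl
  | case3 n ih =>
    simp only [verticalTwists, neg_mul', ih]
    rfl

theorem neg_integer (n : ℤ) : -integer n = integer (-n) := by
  -- Zero is separate: `decide (0 ≤ n)` does not flip under negation there, but no crossing is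
  -- present.
  rcases eq_or_ne n 0 with rfl | hn
  · rfl
  · have : (!decide (0 ≤ n)) = decide (0 ≤ -n) := by
      rw [← decide_not, decide_eq_decide]; omega
    rw [integer, neg_horizontalTwists, this, integer, Int.natAbs_neg]

theorem neg_vertical (n : ℤ) : -vertical n = vertical (-n) := by
  rcases eq_or_ne n 0 with rfl | hn
  · rfl
  · have : (!decide (0 ≤ n)) = decide (0 ≤ -n) := by
      rw [← decide_not, decide_eq_decide]; omega
    rw [vertical, neg_verticalTwists, this, vertical, Int.natAbs_neg]

end TwoTangle

namespace TwistForm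

/-- The mirror image of a twist form. -/
def neg : TwistForm → TwistForm
  | zero => zero
  | infty => infty
  | addRight E n => addRight E.neg (-n)
  | addLeft n E => addLeft (-n) E.neg
  | mulBottom E n => mulBottom E.neg (-n)
  | mulTop n E => mulTop (-n) E.neg

theorem tangle_neg (E : TwistForm) : E.neg.tangle = -E.tangle := by
  induction E with
  | zero => rfl
  | infty => rfl
  | addRight E n ih => simp only [neg, tangle, ih, TwoTangle.neg_add', TwoTangle.neg_integer]
  | addLeft n E ih => simp only [neg, tangle, ih, TwoTangle.neg_add', TwoTangle.neg_integer]
  | mulBottom E n ih => simp only [neg, tangle, ih, TwoTangle.neg_mul', TwoTangle.neg_vertical]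
  | mulTop n E ih => simp only [neg, tangle, ih, TwoTangle.neg_mul', TwoTangle.neg_vertical]

end TwistForm

/-! ### Arithmetic of formal fractions -/

namespace ExtRat

@[simp] theorem neg_coe (x : ℚ) : neg (x : OnePoint ℚ) = ((-x : ℚ) : OnePoint ℚ) := rfl

@[simp] theorem neg_infty : neg OnePoint.infty = OnePoint.infty := rfl

@[simp] theorem inv_coe (x : ℚ) : inv (x : OnePoint ℚ) =
    if x = 0 then OnePoint.infty else ((x⁻¹ : ℚ) : OnePoint ℚ) := rfl

@[simp] theorem inv_infty : inv OnePoint.infty = ((0 : ℚ) : OnePoint ℚ) := rfl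

@[simp] theorem add_coe (x y : ℚ) : add (x : OnePoint ℚ) (y : OnePoint ℚ) =
    ((x + y : ℚ) : OnePoint ℚ) := rfl

@[simp] theorem infty_add (x : OnePoint ℚ) : add OnePoint.infty x = OnePoint.infty := rfl

@[simp] theorem add_infty (x : OnePoint ℚ) : add x OnePoint.infty = OnePoint.infty := by
  cases x <;> rfl

theorem add_comm (x y : OnePoint ℚ) : add x y = add y x := by
  cases x <;> cases y <;> simp [_root_.add_comm]

theorem neg_neg (x : OnePoint ℚ) : neg (neg x) = x := by
  cases x <;> simp

theorem inv_neg (x : OnePoint ℚ) : inv (neg x) = neg (inv x) := by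
  cases x with
  | infty => simp
  | coe x => by_cases h : x = 0 <;> simp [h, _root_.inv_neg]

theorem neg_add (x y : OnePoint ℚ) : neg (add x y) = add (neg x) (neg y) := by
  cases x <;> cases y <;> simp [_root_.add_comm]

theorem neg_star (x y : OnePoint ℚ) : neg (star x y) = star (neg x) (neg y) := by
  simp only [star, inv_neg, ← neg_add]

theorem star_comm (x y : OnePoint ℚ) : star x y = star y x := by
  rw [star, add_comm, star]

theorem neg_ratio (p q : ℤ) : neg (ratio p q) = ratio (-p) q := by
  by_cases h : q = 0 <;> simp [ratio, h, neg_div]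

theorem ratio_neg_right (p q : ℤ) : ratio p (-q) = ratio (-p) q := by
  by_cases h : q = 0 <;> simp [ratio, h, neg_div, div_neg]

theorem inv_ratio {p q : ℤ} (h : p ≠ 0 ∨ q ≠ 0) : inv (ratio p q) = ratio q p := by
  by_cases hq : q = 0
  · have hp : p ≠ 0 := by tauto
    simp [ratio, hq, hp]
  · by_cases hp : p = 0 <;> simp [ratio, hq, hp]

/-- No nondegeneracy is needed: for `q = 0` both sides are `∞`, even when a fraction is `0 / 0`. -/
theorem ratio_add_ratio (p r q : ℤ) : add (ratio p q) (ratio r q) = ratio (p + r) q := by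
  by_cases hq : q = 0 <;> simp [ratio, hq, add_div]

theorem ratio_add_int (p q n : ℤ) : add (ratio p q) (ratio n 1) = ratio (p + n * q) q := by
  by_cases hq : q = 0
  · simp [ratio, hq]
  · have hq' : (q : ℚ) ≠ 0 := by exact_mod_cast hq
    simp [ratio, hq]
    field_simp

/-- Inversion exchanges numerator and denominator and turns `*` into the addition of an integer. -/
theorem ratio_star_vertical {p q : ℤ} (h : p ≠ 0 ∨ q ≠ 0) (n : ℤ) :
    star (ratio p q) (ratio 1 n) = ratio p (q + n * p) := by
  rw [star, inv_ratio h, inv_ratio (.inl one_ne_zero), ratio_add_int, inv_ratio]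
  grind

theorem ratio_eq_ratio {p q r s : ℤ} (h : p ≠ 0 ∨ q ≠ 0) (h' : r ≠ 0 ∨ s ≠ 0)
    (e : q * r = p * s) : ratio r s = ratio p q := by
  by_cases hq : q = 0
  · have hs : s = 0 := by simp_all
    simp [ratio, hq, hs]
  · by_cases hs : s = 0
    · simp_all
    · have hq' : (q : ℚ) ≠ 0 := by exact_mod_cast hq
      have hs' : (s : ℚ) ≠ 0 := by exact_mod_cast hs
      have e' : (q : ℚ) * r = p * s := by exact_mod_cast e
      simp only [ratio, hq, hs, if_false, OnePoint.coe_eq_coe]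
      rw [div_eq_div_iff hs' hq']
      linarith

end ExtRat

theorem TwistForm.fraction_neg (E : TwistForm) : E.neg.fraction = ExtRat.neg E.fraction := by
  induction E with
  | zero => simp [neg, fraction]
  | infty => rfl
  | addRight E n ih => simp only [neg, fraction, ih, ExtRat.neg_add, ExtRat.neg_ratio]
  | addLeft n E ih => simp only [neg, fraction, ih, ExtRat.neg_add, ExtRat.neg_ratio]
  | mulBottom E n ih =>
    simp only [neg, fraction, ih, ExtRat.neg_star, ExtRat.neg_ratio, ExtRat.ratio_neg_right]
  | mulTop n E ih =>
    simp only [neg, fraction, ih, ExtRat.neg_star, ExtRat.neg_ratio, ExtRat.ratio_neg_right]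

/-! ### Colour matrices of rational tangles -/

namespace TwoTangle

/-- Here `x` and `y` are the colours of the strands joining `T` and `S` at the top and at the
bottom. -/
theorem boundaryColoring_add (T S : TwoTangle) (u v : ℕ → ℤ) :
    BoundaryColoring (T + S).layers 2 u v ↔ ∃ x y : ℤ,
      BoundaryColoring T.layers 2 (triple (u 0) x 0) (triple (v 0) y 0) ∧
      BoundaryColoring S.layers 2 (triple x (u 1) 0) (triple y (v 1) 0) := by
  have hc : IsDiagram [⟨1, .cap⟩] 2 4 := by simp [IsDiagram, Piece.ins, Layer.out, Piece.outs]
  have hd : IsDiagram [⟨1, .cup⟩] 4 2 := by simp [IsDiagram, Piece.ins, Layer.out, Piece.outs]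
  have hT : IsDiagram T.layers 4 4 := T.isDiagram.padRight 2
  have hS : IsDiagram (S.layers.map (Layer.shift 2)) 4 4 := S.isDiagram.padLeft 2
  change BoundaryColoring ([⟨1, .cap⟩] ++ T.layers ++ S.layers.map (Layer.shift 2) ++
    [⟨1, .cup⟩]) 2 u v ↔ _
  rw [boundaryColoring_append ((hc.append hT).append hS) hd]
  simp only [boundaryColoring_append (hc.append hT) hS, boundaryColoring_append hc hT]
  have eT := boundaryColoring_padRight T.isDiagram 2
  have eS := boundaryColoring_padLeft S.isDiagram 2
  norm_num only at eT eS
  simp only [eT, eS, forall_lt_two_iff]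
  simp [BoundaryColoring, Layer.IsColored, Layer.out, Piece.ins, Piece.outs, forall_add_lt_iff]
  constructor
  · rintro ⟨w3, ⟨w2, ⟨w1, h1, h2, h3⟩, h4, h5⟩, w4, h6, h7⟩
    refine ⟨w1 1, w2 1, h2.congr T.isDiagram ?_ ?_, h5.congr S.isDiagram ?_ ?_⟩ <;>
      rw [forall_lt_two_iff] <;> grind [triple]
  · rintro ⟨x, y, h1, h2⟩
    -- From the bottom up, the colours at the inner levels are `(v 0, y, y, v 1)`, `(v 0, y, x, u
    -- 1)` and `(u 0, x, x, u 1)`.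
    refine ⟨fun j => if j = 0 then v 0 else if j = 3 then v 1 else y,
      ⟨fun j => if j = 0 then v 0 else if j = 1 then y else if j = 2 then x else u 1,
      ⟨fun j => if j = 0 then u 0 else if j = 3 then u 1 else x, ⟨_, ?_, fun _ _ => rfl⟩, ?_, ?_⟩,
        ?_, ?_⟩, v, ?_, fun _ _ => rfl⟩
    · grind
    · refine h1.congr T.isDiagram ?_ ?_ <;> rw [forall_lt_two_iff] <;> grind [triple]
    · grind
    · grind
    · refine h2.congr S.isDiagram ?_ ?_ <;> rw [forall_lt_two_iff] <;> grind [triple]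
    · grind

theorem boundaryColoring_mul (T S : TwoTangle) (u v : ℕ → ℤ) :
    BoundaryColoring (T * S).layers 2 u v ↔ ∃ w,
      BoundaryColoring T.layers 2 u w ∧ BoundaryColoring S.layers 2 w v :=
  boundaryColoring_append T.isDiagram S.isDiagram u v

/-- The colour matrices of `T` are those which satisfy the diagonal sum rule and have, if it is
defined, the fraction `p / q`. -/
def HasColorRatio (T : TwoTangle) (p q : ℤ) : Prop :=
  ∀ u v : ℕ → ℤ, BoundaryColoring T.layers 2 u v ↔
    u 0 + v 1 = u 1 + v 0 ∧ q * (u 1 - u 0) = p * (u 1 - v 1)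

namespace HasColorRatio

theorem zero : HasColorRatio zero 0 1 := by
  intro u v
  simp [TwoTangle.zero, BoundaryColoring, Layer.IsColored, Layer.out, Piece.ins, Piece.outs]
  constructor
  · rintro ⟨⟨-, h1⟩, w, h2, h3⟩
    grind
  · intro h
    exact ⟨⟨⟨u, by intro j hj; omega⟩, by grind⟩, v, by grind, by grind⟩

theorem infty : HasColorRatio infty 1 0 := by
  intro u v
  simp only [TwoTangle.infty, BoundaryColoring, forall_lt_two_iff]
  grind

theorem one (s : Bool) : HasColorRatio (one s) (if s then 1 else -1) 1 := by
  intro u v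
  cases s <;>
  · simp [TwoTangle.one, BoundaryColoring, Layer.IsColored, Layer.out, Piece.ins, Piece.outs]
    constructor
    · rintro ⟨w, h, h'⟩
      grind
    · intro h
      exact ⟨v, by grind, by grind⟩

/-- The diagonal rule for `S` makes the denominators agree. Since the second fraction has
denominator `1`, its equation determines the joining colours without division, so integrality is no
obstruction. -/
theorem add {T S : TwoTangle} {p q r : ℤ} (hT : T.HasColorRatio p q)
    (hS : S.HasColorRatio r 1) : (T + S).HasColorRatio (p + r * q) q := by
  intro u v
  simp only [boundaryColoring_add, hT _ _, hS _ _, triple, one_mul]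
  constructor
  · rintro ⟨x, y, ⟨h1, h2⟩, h3, h4⟩
    refine ⟨by linarith, ?_⟩
    have : x - y = u 1 - v 1 := by linarith
    rw [this] at h2
    linear_combination h2 + q * h4
  · rintro ⟨h1, h2⟩
    refine ⟨u 1 - r * (u 1 - v 1), v 1 - r * (u 1 - v 1), ⟨by linarith, ?_⟩, by linarith, by ring⟩
    linear_combination h2

theorem add_left {T S : TwoTangle} {p q r : ℤ} (hT : T.HasColorRatio p q)
    (hS : S.HasColorRatio r 1) : (S + T).HasColorRatio (p + r * q) q := by
  intro u v
  simp only [boundaryColoring_add, hT _ _, hS _ _, triple, one_mul]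
  constructor
  · rintro ⟨x, y, ⟨h1, h2⟩, h3, h4⟩
    refine ⟨by linarith, ?_⟩
    have : x - y = u 1 - v 1 := by linarith
    rw [this] at h2
    linear_combination h4 + q * h2
  · rintro ⟨h1, h2⟩
    refine ⟨u 0 + r * (u 1 - v 1), v 0 + r * (u 1 - v 1), ⟨by linarith, ?_⟩, by linarith, ?_⟩
    · linear_combination -r * h1
    · linear_combination h2

theorem mul {T S : TwoTangle} {p q r : ℤ} (hT : T.HasColorRatio p q)
    (hS : S.HasColorRatio 1 r) : (T * S).HasColorRatio p (q + r * p) := by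
  intro u v
  simp only [boundaryColoring_mul, hT _ _, hS _ _, one_mul]
  constructor
  · rintro ⟨w, ⟨h1, h2⟩, h3, h4⟩
    refine ⟨by linarith, ?_⟩
    have : w 1 - w 0 = u 1 - u 0 := by linarith
    rw [this] at h4
    linear_combination h2 + p * h4
  · rintro ⟨h1, h2⟩
    -- Forced by `S`: its numerator is `u 1 - u 0`, so its denominator `w 1 - v 1` is `r` times
    -- that.
    refine ⟨triple (v 0 + r * (u 1 - u 0)) (v 1 + r * (u 1 - u 0)) 0, ?_⟩
    simp only [triple]
    refine ⟨⟨by linarith, ?_⟩, by linarith, ?_⟩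
    · linear_combination h2
    · linear_combination r * h1

theorem mul_left {T S : TwoTangle} {p q r : ℤ} (hT : T.HasColorRatio p q)
    (hS : S.HasColorRatio 1 r) : (S * T).HasColorRatio p (q + r * p) := by
  intro u v
  simp only [boundaryColoring_mul, hT _ _, hS _ _, one_mul]
  constructor
  · rintro ⟨w, ⟨h1, h2⟩, h3, h4⟩
    refine ⟨by linarith, ?_⟩
    have : w 1 - w 0 = u 1 - u 0 := by linarith
    rw [this] at h4
    linear_combination h4 + p * h2
  · rintro ⟨h1, h2⟩
    refine ⟨triple (u 0 - r * (u 1 - u 0)) (u 1 - r * (u 1 - u 0)) 0, ?_⟩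
    simp only [triple]
    refine ⟨⟨by linarith, by ring⟩, by linarith, ?_⟩
    linear_combination h2

theorem horizontalTwists (s : Bool) (n : ℕ) :
    (horizontalTwists s n).HasColorRatio (n * if s then 1 else -1) 1 := by
  induction n using TwoTangle.horizontalTwists.induct with
  | case1 => simpa [TwoTangle.horizontalTwists] using zero
  | case2 => simpa [TwoTangle.horizontalTwists] using one s
  | case3 n ih =>
    convert ih.add (one s) using 1
    · rfl
    · simp only [Nat.succ_eq_add_one]
      push_cast
      ring

theorem verticalTwists (s : Bool) (n : ℕ) :
    (verticalTwists s n).HasColorRatio 1 (n * if s then 1 else -1) := by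
  -- A single crossing is both a horizontal and a vertical twist, as `±1` is its own inverse.
  have h1 : (TwoTangle.one s).HasColorRatio 1 (if s then 1 else -1) := by
    intro u v
    rw [one s u v]
    cases s <;> grind
  induction n using TwoTangle.verticalTwists.induct with
  | case1 => simpa [TwoTangle.verticalTwists] using infty
  | case2 => simpa [TwoTangle.verticalTwists] using h1
  | case3 n ih =>
    convert ih.mul h1 using 1
    · rfl
    · simp only [Nat.succ_eq_add_one]
      push_cast
      ring

theorem natAbs_mul_sign_eq (n : ℤ) :
    ((n.natAbs : ℤ) * if decide (0 ≤ n) = true then 1 else -1) = n := by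
  simp only [decide_eq_true_eq]
  split_ifs <;> omega

theorem integer (n : ℤ) : (integer n).HasColorRatio n 1 := by
  have h := horizontalTwists (decide (0 ≤ n)) n.natAbs
  rwa [natAbs_mul_sign_eq] at h

theorem vertical (n : ℤ) : (vertical n).HasColorRatio 1 n := by
  have h := verticalTwists (decide (0 ≤ n)) n.natAbs
  rwa [natAbs_mul_sign_eq] at h

end HasColorRatio

theorem _root_.TwistForm.exists_hasColorRatio (E : TwistForm) : ∃ p q : ℤ, (p ≠ 0 ∨ q ≠ 0) ∧
    E.fraction = ExtRat.ratio p q ∧ E.tangle.HasColorRatio p q := by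
  induction E with
  | zero => exact ⟨0, 1, by simp, by simp [TwistForm.fraction, ExtRat.ratio], .zero⟩
  | infty => exact ⟨1, 0, by simp, by simp [TwistForm.fraction, ExtRat.ratio], .infty⟩
  | addRight E n ih =>
    obtain ⟨p, q, h, hf, hE⟩ := ih
    refine ⟨_, _, ?_, ?_, hE.add (.integer n)⟩
    · grind
    · rw [TwistForm.fraction, hf, ExtRat.ratio_add_int]
  | addLeft n E ih =>
    obtain ⟨p, q, h, hf, hE⟩ := ih
    refine ⟨_, _, ?_, ?_, hE.add_left (.integer n)⟩
    · grind
    · rw [TwistForm.fraction, hf, ExtRat.add_comm, ExtRat.ratio_add_int]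
  | mulBottom E n ih =>
    obtain ⟨p, q, h, hf, hE⟩ := ih
    refine ⟨_, _, ?_, ?_, hE.mul (.vertical n)⟩
    · grind
    · rw [TwistForm.fraction, hf, ExtRat.ratio_star_vertical h]
  | mulTop n E ih =>
    obtain ⟨p, q, h, hf, hE⟩ := ih
    refine ⟨_, _, ?_, ?_, hE.mul_left (.vertical n)⟩
    · grind
    · rw [TwistForm.fraction, hf, ExtRat.star_comm, ExtRat.ratio_star_vertical h]

theorem HasColorRatio.hasFraction {T : TwoTangle} {p q : ℤ} (hT : T.HasColorRatio p q)
    (h : p ≠ 0 ∨ q ≠ 0) : T.HasFraction (ExtRat.ratio p q) := by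
  constructor
  -- The matrix with rows `(0, p)` and `(-q, p - q)` has `b - a = p` and `b - d = q`, which are not
  -- both zero.
  · have h' := (hT (triple 0 p 0) (triple (-q) (p - q) 0)).2
      ⟨by simp [triple]; ring, by simp [triple]; ring⟩
    obtain ⟨c, hc, hu, hv⟩ := (boundaryColoring_iff T.isDiagram _ _).1 h'
    rw [forall_lt_two_iff] at hu hv
    refine ⟨c, hc, ?_⟩
    simp [FractionDefined, colorMatrix, hu, hv, triple]
    tauto
  · intro c hc hd
    have h' := (hT (c 0) (c T.layers.length)).1
      ((boundaryColoring_iff T.isDiagram _ _).2 ⟨c, hc, fun _ _ => rfl, fun _ _ => rfl⟩)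
    refine ExtRat.ratio_eq_ratio h ?_ h'.2
    simpa [FractionDefined, colorMatrix, imp_iff_not_or] using hd

theorem Isotopic.hasFraction {T : TwoTangle} {E : TwistForm} (h : Isotopic T E.tangle) :
    T.HasFraction E.fraction := by
  obtain ⟨p, q, h0, hf, hE⟩ := E.exists_hasColorRatio
  rw [hf]
  exact HasColorRatio.hasFraction (fun u v => (h.boundaryColoring_iff u v).trans (hE u v)) h0

theorem HasFraction.unique {T : TwoTangle} {q q' : OnePoint ℚ} (h : T.HasFraction q)
    (h' : T.HasFraction q') : q = q' := by
  obtain ⟨c, hc, hd⟩ := h.1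
  exact (h.2 c hc hd).symm.trans (h'.2 c hc hd)

theorem IsColoring.diagonal_sum {T : TwoTangle} {c : ℕ → ℕ → ℤ} (hc : T.IsColoring c) :
    c 0 0 + c T.layers.length 1 = c 0 1 + c T.layers.length 0 := by
  have := IsColoredDiagram.alternatingSum_eq T.isDiagram hc
  simp [alternatingSum, Finset.sum_range_succ] at this
  linarith

end TwoTangle

/-! ### Colourings of sums and rotations, mirror images and inverses -/

namespace TwoTangle

/-- `T` starts at level `1`, below the maximum, with no strand on its left; `S` starts below `T`,
with two strands on its left. The equations trace the passing strands to the endpoints of the sum.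
-/
theorem IsColoring.of_add {T S : TwoTangle} {c : ℕ → ℕ → ℤ} (hc : (T + S).IsColoring c) :
    c 1 0 = c 0 0 ∧ c 1 3 = c 0 1 ∧ c 1 1 = c 1 2 ∧
    (T.IsColoring (restrict 1 0 c) ∧
      ∀ j < 2, c (1 + T.layers.length) (2 + j) = c 1 (2 + j)) ∧
    (S.IsColoring (restrict (1 + T.layers.length) 2 c) ∧
      ∀ j < 2, c (1 + T.layers.length + S.layers.length) j = c (1 + T.layers.length) j) ∧
    c (T + S).layers.length 0 = c (1 + T.layers.length + S.layers.length) 0 ∧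
    c (T + S).layers.length 1 = c (1 + T.layers.length + S.layers.length) 3 ∧
    c (1 + T.layers.length + S.layers.length) 1 =
      c (1 + T.layers.length + S.layers.length) 2 := by
  have hcap : IsDiagram [⟨1, .cap⟩] 2 4 := by simp [IsDiagram, Piece.ins, Layer.out, Piece.outs]
  have hT : IsDiagram T.layers 4 4 := T.isDiagram.padRight 2
  have hS : IsDiagram (S.layers.map (Layer.shift 2)) 4 4 := S.isDiagram.padLeft 2
  have hlen : (T + S).layers.length = 1 + T.layers.length + S.layers.length + 1 := by
    change ([_] ++ T.layers ++ List.map _ S.layers ++ [_]).length = _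
    simp only [List.length_append, List.length_map, List.length_singleton]
  change IsColoredDiagram ([⟨1, .cap⟩] ++ T.layers ++ S.layers.map (Layer.shift 2) ++
    [⟨1, .cup⟩]) 2 c at hc
  rw [isColoredDiagram_append ((hcap.append hT).append hS),
    isColoredDiagram_append (hcap.append hT), isColoredDiagram_append hcap] at hc
  obtain ⟨⟨⟨h1, h2⟩, h3⟩, h4⟩ := hc
  obtain ⟨h2, h2'⟩ := (isColoredDiagram_padRight T.isDiagram 2 _).1 h2
  obtain ⟨h3, h3'⟩ := (isColoredDiagram_padLeft S.isDiagram 2 _).1 h3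
  have h2e := h2' _ le_rfl
  have h3e := h3' _ le_rfl
  rw [T.isDiagram.levelWidth_length] at h2e
  simp only [List.length_append, List.length_map, List.length_singleton, add_zero]
    at h2 h3 h2e h3e h4
  simp [IsColoredDiagram, Layer.IsColored, Piece.ins, Piece.outs] at h1
  obtain ⟨⟨h5, h6, h7⟩, -⟩ := h4
  simp only [Piece.ins, Piece.outs, Nat.reduceAdd, add_zero] at h5 h6 h7
  rw [hlen]
  refine ⟨h1.1, h1.2.1, h1.2.2, ⟨?_, h2e⟩, ⟨h3, h3e⟩, h5 0 one_pos, h6 0 (by decide), h7⟩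
  have e : restrict 1 0 c = fun i => c (1 + i) := by
    funext i j
    rw [restrict, zero_add]
  rwa [IsColoring, e]

theorem isColoring_rotate_iff {T : TwoTangle} {c : ℕ → ℕ → ℤ} : T.rotate.IsColoring c ↔
    Layer.IsColored ⟨0, .cap⟩ 2 (c 0) (c 1) ∧
    T.IsColoring (restrict 1 1 c) ∧
    (∀ i ≤ T.layers.length, c (1 + i) 0 = c 1 0) ∧
    (∀ i ≤ T.layers.length, c (1 + i) (1 + T.width i) = c 1 3) ∧
    Layer.IsColored ⟨2, .cup⟩ 4 (c (1 + T.layers.length)) (c (1 + T.layers.length + 1)) := by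
  have hcap : IsDiagram [⟨0, .cap⟩] 2 4 := by simp [IsDiagram, Piece.ins, Layer.out, Piece.outs]
  have hT := T.isDiagram.padLeft 1
  have hT' : IsDiagram (T.layers.map (Layer.shift 1)) 4 4 := hT.padRight 1
  change IsColoredDiagram ([⟨0, .cap⟩] ++ T.layers.map (Layer.shift 1) ++ [⟨2, .cup⟩]) 2 c ↔ _
  rw [isColoredDiagram_append (hcap.append hT'), isColoredDiagram_append hcap]
  have e := isColoredDiagram_padRight hT 1
  simp only [Nat.reduceAdd, levelWidth_map_shift T.isDiagram] at e
  have e' := isColoredDiagram_padLeft T.isDiagram 1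
  norm_num only at e'
  rw [e, e']
  simp only [IsColoredDiagram, IsColoring, List.length_map, List.length_append,
    List.length_singleton, Nat.lt_one_iff, forall_eq, and_true, add_zero, and_assoc]
  rfl

theorem IsColoring.of_rotate {T : TwoTangle} {c : ℕ → ℕ → ℤ} (hc : T.rotate.IsColoring c) :
    T.IsColoring (restrict 1 1 c) ∧ c 0 0 = c 1 2 ∧ c 0 1 = c (1 + T.layers.length) 2 ∧
      c T.rotate.layers.length 0 = c 1 1 ∧
      c T.rotate.layers.length 1 = c (1 + T.layers.length) 1 := by
  have hlen : T.rotate.layers.length = 1 + T.layers.length + 1 := by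
    change ([_] ++ List.map _ T.layers ++ [_]).length = _
    simp only [List.length_append, List.length_map, List.length_singleton]
  obtain ⟨⟨-, h1, h1'⟩, hT, h2, h3, h4, -, h4'⟩ := isColoring_rotate_iff.1 hc
  have h3' := h3 _ le_rfl
  rw [width, T.isDiagram.levelWidth_length] at h3'
  have a0 := h1 0 (by decide)
  have a1 := h1 1 (by decide)
  have b0 := h4 0 (by decide)
  have b1 := h4 1 (by decide)
  have b2 := h2 _ le_rfl
  simp only [Piece.ins, Piece.outs, Nat.reduceAdd, add_zero, zero_add] at a0 a1 h1' h3' h4' b0 b1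
  rw [hlen]
  exact ⟨hT, a0.symm, by grind, by grind, by grind⟩

theorem IsColoring.exists_rotate {T : TwoTangle} {c : ℕ → ℕ → ℤ} (hc : T.IsColoring c) :
    ∃ c' : ℕ → ℕ → ℤ, T.rotate.IsColoring c' ∧
      ∀ i ≤ T.layers.length, ∀ j < T.width i, restrict 1 1 c' i j = c i j := by
  have w0 : T.width 0 = 2 := levelWidth_zero _ _
  have w1 : T.width T.layers.length = 2 := T.isDiagram.levelWidth_length
  -- The strand led around the left of `T` carries the colour of NW, the one on the right that of
  -- SE. So the top row is `(NE, SE)` and the bottom row `(NW, SW)`, in terms of the colours of `T`.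
  let c' : ℕ → ℕ → ℤ := fun i j =>
    if i = 0 then if j = 0 then c 0 1 else c T.layers.length 1
    else if i ≤ T.layers.length + 1 then
      if j = 0 then c 0 0 else if j - 1 < T.width (i - 1) then c (i - 1) (j - 1)
        else c T.layers.length 1
    else if j = 0 then c 0 0 else c T.layers.length 0
  have hr : ∀ i ≤ T.layers.length, ∀ j < T.width i, restrict 1 1 c' i j = c i j := by
    intro i hi j hj
    have h1 : i + 1 ≤ T.layers.length + 1 := by omega
    simp [c', restrict, add_comm 1, h1, hj]
  refine ⟨c', isColoring_rotate_iff.2 ⟨⟨?_, ?_, ?_⟩, ?_, ?_, ?_, ?_, ?_, ?_⟩, hr⟩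
  · intro j hj
    simp at hj
  · intro j hj
    simp only [Piece.ins, zero_add] at hj
    interval_cases j <;> simp [c', w0, Piece.ins, Piece.outs]
  · simp [c', w0]
  · exact hc.congr T.isDiagram fun i hi j hj => (hr i hi j hj).symm
  · intro i hi
    simp [c']
  · intro i hi
    simp [c', w0, hi, add_comm 1]
  · intro j hj
    simp only at hj
    interval_cases j <;> simp [c', w1, add_comm 1]
  · intro j hj
    simp [Piece.ins] at hj
  · simp [c', w1, add_comm 1]

theorem matrixFraction_add {T S : TwoTangle} {c : ℕ → ℕ → ℤ} (hc : (T + S).IsColoring c) :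
    matrixFraction ((T + S).colorMatrix c) =
      ExtRat.add (matrixFraction (T.colorMatrix (restrict 1 0 c)))
        (matrixFraction (S.colorMatrix (restrict (1 + T.layers.length) 2 c))) := by
  obtain ⟨h1, h2, h3, ⟨hT, h4⟩, ⟨hS, h5⟩, h6, h7, h8⟩ := hc.of_add
  have dT := hT.diagonal_sum
  have dS := hS.diagonal_sum
  rw [forall_lt_two_iff] at h4 h5
  simp only [matrixFraction, colorMatrix, restrict, Matrix.of_apply, Matrix.cons_val',
    Matrix.cons_val_zero, Matrix.cons_val_one, Matrix.cons_val_fin_one, add_zero, zero_add,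
    Nat.reduceAdd] at dT dS h4 h5 ⊢
  -- By the two diagonal rules all three denominators coincide, so only numerators are added.
  rw [show c 1 1 - c (1 + T.layers.length) 1 = c 0 1 - c (T + S).layers.length 1 by linarith,
    show c (1 + T.layers.length) 3 - c (1 + T.layers.length + S.layers.length) 3 =
      c 0 1 - c (T + S).layers.length 1 by linarith, ExtRat.ratio_add_ratio]
  congr 1
  linarith

/-- In the colours of `T` the rotated fraction is `(d - b) / (d - c)`, and `d - c = b - a` by the
diagonal rule: numerator and denominator are exchanged up to one sign. -/
theorem fraction_rotate {T : TwoTangle} {c : ℕ → ℕ → ℤ} (hc : T.rotate.IsColoring c) :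
    (FractionDefined (T.rotate.colorMatrix c) ↔
      FractionDefined (T.colorMatrix (restrict 1 1 c))) ∧
    (FractionDefined (T.colorMatrix (restrict 1 1 c)) →
      matrixFraction (T.rotate.colorMatrix c) =
        ExtRat.neg (ExtRat.inv (matrixFraction (T.colorMatrix (restrict 1 1 c))))) := by
  obtain ⟨hT, h1, h2, h3, h4⟩ := hc.of_rotate
  have dT := hT.diagonal_sum
  simp only [matrixFraction, FractionDefined, colorMatrix, restrict, Matrix.of_apply,
    Matrix.cons_val', Matrix.cons_val_zero, Matrix.cons_val_one, Matrix.cons_val_fin_one,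
    add_zero, Nat.reduceAdd] at dT ⊢
  rw [show c 0 1 - c 0 0 = -(c 1 2 - c (1 + T.layers.length) 2) by linarith,
    show c 0 1 - c T.rotate.layers.length 1 = c 1 2 - c 1 1 by linarith]
  refine ⟨by rw [neg_eq_zero]; tauto, fun h => ?_⟩
  rw [ExtRat.inv_ratio (by tauto), ExtRat.neg_ratio]

theorem HasFraction.rotate {T : TwoTangle} {q : OnePoint ℚ} (h : T.HasFraction q) :
    T.rotate.HasFraction (ExtRat.neg (ExtRat.inv q)) := by
  constructor
  · obtain ⟨c, hc, hd⟩ := h.1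
    obtain ⟨c', hc', e⟩ := hc.exists_rotate
    refine ⟨c', hc', (fraction_rotate hc').1.2 ?_⟩
    have e0 := e 0 (Nat.zero_le _)
    have e1 := e _ le_rfl
    rw [width, T.isDiagram.levelWidth_length] at e1
    rw [width, levelWidth_zero] at e0
    have : T.colorMatrix (restrict 1 1 c') = T.colorMatrix c := by
      rw [colorMatrix, e0 0 two_pos, e0 1 one_lt_two, e1 0 two_pos, e1 1 one_lt_two, colorMatrix]
    rwa [this]
  · intro c hc hd
    have hd' := (fraction_rotate hc).1.1 hd
    rw [(fraction_rotate hc).2 hd', h.2 _ hc.of_rotate.1 hd']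

/-- A colouring of `T` gives no evident colouring of `-T`, so the argument passes through a twist
form, where negation is visible in `F`. -/
theorem HasFraction.neg {T : TwoTangle} {q : OnePoint ℚ} (h : T.HasFraction q)
    (hT : T.IsRational) : (-T).HasFraction (ExtRat.neg q) := by
  obtain ⟨E, hE⟩ := hT
  have e := hE.neg
  rw [← E.tangle_neg] at e
  rw [h.unique hE.hasFraction, ← E.fraction_neg]
  exact e.hasFraction

/-- Taking the mirror image before rotating avoids having to show that the rotation of a rational
tangle is rational. -/
theorem HasFraction.inverse {T : TwoTangle} {q : OnePoint ℚ} (h : T.HasFraction q)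
    (hT : T.IsRational) : T.inverse.HasFraction (ExtRat.inv q) := by
  have h' := (h.neg hT).rotate
  rwa [ExtRat.inv_neg, ExtRat.neg_neg, ← neg_rotate] at h'

end TwoTangle
theorem theorem4 :
    -- 1. the diagonal sum rule
    (∀ (T : TwoTangle) (c : ℕ → ℕ → ℤ), T.IsColoring c →
      (T.colorMatrix c) 0 0 + (T.colorMatrix c) 1 1 =
        (T.colorMatrix c) 0 1 + (T.colorMatrix c) 1 0) ∧
    -- 2. `f` is a well-defined isotopy invariant of rational tangles
    (∀ T : TwoTangle, T.IsRational →
      ∃ q : OnePoint ℚ, ∀ T' : TwoTangle, TwoTangle.Isotopic T T' → T'.HasFraction q) ∧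
    -- 3. additivity, for the restrictions of a colouring of `T + S` to `T` and `S`
    (∀ (T S : TwoTangle) (c : ℕ → ℕ → ℤ), (T + S).IsColoring c →
      T.IsColoring (TwoTangle.restrict 1 0 c) ∧
      S.IsColoring (TwoTangle.restrict (1 + T.layers.length) 2 c) ∧
      (FractionDefined (T.colorMatrix (TwoTangle.restrict 1 0 c)) →
        FractionDefined (S.colorMatrix (TwoTangle.restrict (1 + T.layers.length) 2 c)) →
        FractionDefined ((T + S).colorMatrix c) →
        matrixFraction ((T + S).colorMatrix c) =
          ExtRat.add (matrixFraction (T.colorMatrix (TwoTangle.restrict 1 0 c)))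
            (matrixFraction
              (S.colorMatrix (TwoTangle.restrict (1 + T.layers.length) 2 c))))) ∧
    -- 4. rotation, for every coloured 2-tangle: colourings of `T` extend to `T.rotate`,
    -- and every colouring of `T.rotate` restricts to `T`
    (∀ (T : TwoTangle) (c : ℕ → ℕ → ℤ), T.IsColoring c →
      ∃ c' : ℕ → ℕ → ℤ, T.rotate.IsColoring c' ∧
        ∀ i ≤ T.layers.length, ∀ j < T.width i, TwoTangle.restrict 1 1 c' i j = c i j) ∧
    (∀ (T : TwoTangle) (c : ℕ → ℕ → ℤ), T.rotate.IsColoring c →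
      T.IsColoring (TwoTangle.restrict 1 1 c) ∧
      (FractionDefined (T.colorMatrix (TwoTangle.restrict 1 1 c)) →
        FractionDefined (T.rotate.colorMatrix c) ∧
        matrixFraction (T.rotate.colorMatrix c) =
          ExtRat.neg (ExtRat.inv
            (matrixFraction (T.colorMatrix (TwoTangle.restrict 1 1 c)))))) ∧
    (∀ (T : TwoTangle) (q : OnePoint ℚ), T.HasFraction q →
      T.rotate.HasFraction (ExtRat.neg (ExtRat.inv q))) ∧
    -- 5. mirror images of rational tangles
    (∀ (T : TwoTangle) (q : OnePoint ℚ), T.IsRational → T.HasFraction q →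
      (-T).HasFraction (ExtRat.neg q)) ∧
    -- 6. inverses of rational tangles
    (∀ (T : TwoTangle) (q : OnePoint ℚ), T.IsRational → T.HasFraction q →
      T.inverse.HasFraction (ExtRat.inv q)) ∧
    -- 7. the colouring fraction is the arithmetical fraction
    (∀ (T : TwoTangle) (E : TwistForm), TwoTangle.Isotopic T E.tangle →
      T.HasFraction E.fraction) := by
  refine ⟨fun T c hc => hc.diagonal_sum, fun T ⟨E, hE⟩ => ⟨E.fraction, fun T' h => ?_⟩,
    fun T S c hc => ?_, fun T c hc => hc.exists_rotate, fun T c hc => ?_,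
    fun T q h => h.rotate, fun T q hT h => h.neg hT, fun T q hT h => h.inverse hT,
    fun T E h => h.hasFraction⟩
  · exact TwoTangle.Isotopic.hasFraction (.trans _ _ _ (.symm _ _ h) hE)
  · obtain ⟨-, -, -, ⟨hT, -⟩, ⟨hS, -⟩, -⟩ := hc.of_add
    exact ⟨hT, hS, fun _ _ _ => TwoTangle.matrixFraction_add hc⟩
  · exact ⟨hc.of_rotate.1, fun h => ⟨(TwoTangle.fraction_rotate hc).1.2 h,
      (TwoTangle.fraction_rotate hc).2 h⟩⟩
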